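/- Let $m\ge 2$, $n>0$, $A>0$, $C_0>0$, $c_0>0$, let $\phi\in C_0^\infty(\mathbb R)$ with $\operatorname{supp}\phi\subseteq[1/4,4]$, let $M>0$ and let $K\ge 1$ be an integer. Then there is a constant $C>0$, depending only on these data, such that the following holds. Let $(X,d)$ be a metric space with a Borel measure $\mu$; write $B(x,r)=\{y\in X:d(x,y)<r\}$ and $V(x,r)=\mu(B(x,r))$, and suppose that $0<V(x,r)<\infty$ and $V(x,\lambda r)\le A\lambda^nV(x,r)$ for all $x\in X$, $r>0$ and $\lambda\ge1$. For $E\subseteq X$ let $P_Ef=\chi_Ef$ be multiplication by the characteristic function of $E$. Let $L$ be a non-negative self-adjoint operator on $L^2(X,\mu)$ whose semigroup satisfies the $m$-th order Davies–Gaffney estimates $$\big\|P_{B(x,\tau^{1/m})}e^{-\tau L}P_{B(y,\tau^{1/m})}\big\|_{2\to2}\le C_0\exp\Big(-c_0\Big(\frac{d(x,y)}{\tau^{1/m}}\Big)^{\frac m{m-1}}\Big)\qquad\text{for all }\tau>0,\ x,y\in X.$$ Then for all $s>0$, all $t>0$, all integers $k\ge1$, all $c\ge 1/4$, all balls $B_1,B_2\subseteq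 X$ of the same radius $r_{B_1}=r_{B_2}\ge c\,2^{(m-1)k/m}t^{1/m}$, and all $f\in L^2(X,\mu)$, $$\big\|P_{B_1}(I-e^{-sL})^Ke^{itL}\phi(2^{-k}tL)P_{B_2}f\big\|_2\le C\Big(1+\frac{d(B_1,B_2)}{2^{(m-1)k/m}\,t^{1/m}}\Big)^{-M}\|P_{B_2}f\|_2,$$ where $d(B_1,B_2)=\inf\{d(x,y):x\in B_1,\ y\in B_2\}$, and $e^{-sL}$, $e^{itL}$ and $\phi(2^{-k}tL)$ are defined by the spectral theorem. -/

import Mathlib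

open MeasureTheory Filter Topology

noncomputable section

namespace OffDiag

section Calculus

/-- A non-negative self-adjoint, possibly unbounded, operator on a complex Hilbert space.
Self-adjointness means `L† = L` for partially defined operators, including equality of the
domains; with Mathlib's conventions it implies that the domain is dense. -/
structure NonnegSelfAdjoint (H : Type*) [NormedAddCommGroup H] [InnerProductSpace ℂ H]
    [CompleteSpace H] where
  /-- the operator together with its domain -/
  op : H →ₗ.[ℂ] H
  selfAdjoint : IsSelfAdjoint op
  nonneg : ∀ x : op.domain, 0 ≤ (inner ℂ (op x) (x : H)).re

variable {H : Type*} [NormedAddCommGroup H] [InnerProductSpace ℂ H] [CompleteSpace H]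

namespace NonnegSelfAdjoint

theorem symm (L : NonnegSelfAdjoint H) (x y : L.op.domain) :
    inner ℂ (L.op x) (y : H) = inner ℂ (x : H) (L.op y) := by
  have h := LinearPMap.adjoint_isFormalAdjoint L.selfAdjoint.dense_domain
  rw [LinearPMap.isSelfAdjoint_def.mp L.selfAdjoint] at h
  exact h x y

theorem norm_sq_le (L : NonnegSelfAdjoint H) (x : L.op.domain) :
    ‖(x : H)‖ ^ 2 ≤ (inner ℂ ((x : H) + L.op x) (x : H)).re := by
  have h := L.nonneg x
  have h2 : (inner ℂ (x : H) (x : H)).re = ‖(x : H)‖ ^ 2 := by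
    simpa using (inner_self_eq_norm_sq (𝕜 := ℂ) (x : H))
  rw [inner_add_left, Complex.add_re, h2]
  linarith

theorem norm_le (L : NonnegSelfAdjoint H) (x : L.op.domain) :
    ‖(x : H)‖ ≤ ‖(x : H) + L.op x‖ := by
  have h := L.norm_sq_le x
  have h2 : (inner ℂ ((x : H) + L.op x) (x : H)).re ≤ ‖(x : H) + L.op x‖ * ‖(x : H)‖ :=
    (Complex.re_le_norm _).trans (norm_inner_le_norm _ _)
  rcases (norm_nonneg (x : H)).eq_or_lt with h0 | h0
  · rw [← h0]; exact norm_nonneg _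
  · nlinarith

/-- The map `x ↦ x + L x` on the domain of `L`. -/
def oneAdd (L : NonnegSelfAdjoint H) : L.op.domain →ₗ[ℂ] H :=
  L.op.domain.subtype + L.op.toFun

theorem oneAdd_apply (L : NonnegSelfAdjoint H) (x : L.op.domain) :
    L.oneAdd x = (x : H) + L.op x := rfl

theorem oneAdd_injective (L : NonnegSelfAdjoint H) : Function.Injective L.oneAdd := by
  rw [injective_iff_map_eq_zero]
  intro x hx
  have h := L.norm_le x
  rw [← oneAdd_apply, hx, norm_zero] at h
  exact Subtype.ext (norm_le_zero_iff.mp h)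

theorem isClosed_range_oneAdd (L : NonnegSelfAdjoint H) :
    IsClosed (LinearMap.range L.oneAdd : Set H) := by
  have hc : IsClosed (L.op.graph : Set (H × H)) := L.selfAdjoint.isClosed
  rw [isClosed_iff_clusterPt]
  refine fun y hy => ?_
  obtain ⟨u, hu, hlim⟩ := mem_closure_iff_seq_limit.mp (mem_closure_iff_clusterPt.mpr hy)
  choose x hx using hu
  have hcau : CauchySeq (fun n => (x n : H)) := by
    have h1 : CauchySeq u := hlim.cauchySeq
    rw [Metric.cauchySeq_iff] at h1 ⊢
    intro ε hε
    obtain ⟨N, hN⟩ := h1 ε hε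
    refine ⟨N, fun p hp q hq => lt_of_le_of_lt ?_ (hN p hp q hq)⟩
    rw [dist_eq_norm, dist_eq_norm, ← hx p, ← hx q, ← map_sub]
    simpa [oneAdd_apply] using L.norm_le (x p - x q)
  obtain ⟨a, ha⟩ := cauchySeq_tendsto_of_complete hcau
  have hL : Tendsto (fun n => L.op (x n)) atTop (𝓝 (y - a)) := by
    refine (hlim.sub ha).congr fun n => ?_
    rw [← hx n, oneAdd_apply]; simp
  have hmem : (a, y - a) ∈ L.op.graph :=
    hc.mem_of_tendsto (ha.prodMk_nhds hL)
      (Eventually.of_forall fun n => LinearPMap.mem_graph L.op (x n))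
  obtain ⟨z, hz1, hz2⟩ := (LinearPMap.mem_graph_iff L.op).mp hmem
  refine ⟨z, ?_⟩
  rw [oneAdd_apply]
  simp only at hz1 hz2
  rw [hz1, hz2]; simp

theorem oneAdd_surjective (L : NonnegSelfAdjoint H) : Function.Surjective L.oneAdd := by
  have hd := L.selfAdjoint.dense_domain
  have hcl := L.isClosed_range_oneAdd
  have : CompleteSpace (LinearMap.range L.oneAdd) := hcl.completeSpace_coe
  rw [← LinearMap.range_eq_top, ← Submodule.orthogonal_eq_bot_iff, Submodule.eq_bot_iff]
  intro y hy
  have h1 : ∀ x : L.op.domain, inner ℂ (-y) (x : H) = inner ℂ y (L.op x) := by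
    intro x
    have := (Submodule.mem_orthogonal' _ _).mp hy (L.oneAdd x) ⟨x, rfl⟩
    rw [oneAdd_apply, inner_add_right] at this
    rw [inner_neg_left]
    linear_combination -this
  have h2 := LinearPMap.mem_adjoint_domain_of_exists (T := L.op) y ⟨-y, h1⟩
  have h3 := LinearPMap.adjoint_apply_eq hd ⟨y, h2⟩ h1
  have h4 : ∀ T : H →ₗ.[ℂ] H, T = L.op → ∀ h : y ∈ T.domain, T ⟨y, h⟩ = -y →
      ∃ h' : y ∈ L.op.domain, L.op ⟨y, h'⟩ = -y := by
    rintro T rfl h h'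
    exact ⟨h, h'⟩
  obtain ⟨h5, h6⟩ := h4 _ (LinearPMap.isSelfAdjoint_def.mp L.selfAdjoint) h2 h3
  have h7 := L.norm_le ⟨y, h5⟩
  rw [h6] at h7
  simpa using h7

/-- The bounded operator `(1 + L)⁻¹`. -/
def resolvent (L : NonnegSelfAdjoint H) : H →L[ℂ] H :=
  LinearMap.mkContinuous
    (L.op.domain.subtype.comp
      (LinearEquiv.ofBijective L.oneAdd ⟨L.oneAdd_injective, L.oneAdd_surjective⟩).symm.toLinearMap)
    1 (fun y => by
      set e := LinearEquiv.ofBijective L.oneAdd ⟨L.oneAdd_injective, L.oneAdd_surjective⟩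
      have h := L.norm_le (e.symm y)
      have h2 : ((e.symm y : L.op.domain) : H) + L.op (e.symm y) = y := e.apply_symm_apply y
      rw [h2] at h
      simpa using h)

theorem resolvent_spec (L : NonnegSelfAdjoint H) (y : H) :
    ∃ x : L.op.domain, (x : H) = L.resolvent y ∧ (x : H) + L.op x = y := by
  set e := LinearEquiv.ofBijective L.oneAdd ⟨L.oneAdd_injective, L.oneAdd_surjective⟩
  exact ⟨e.symm y, rfl, e.apply_symm_apply y⟩

theorem norm_resolvent_le (L : NonnegSelfAdjoint H) : ‖L.resolvent‖ ≤ 1 :=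
  LinearMap.mkContinuous_norm_le _ zero_le_one _

theorem resolvent_nonneg (L : NonnegSelfAdjoint H) : L.resolvent.IsPositive := by
  rw [ContinuousLinearMap.isPositive_def]
  refine ⟨?_, fun y => ?_⟩
  · intro y z
    obtain ⟨x, hx, hxy⟩ := L.resolvent_spec y
    obtain ⟨w, hw, hwz⟩ := L.resolvent_spec z
    change inner ℂ (L.resolvent y) z = inner ℂ y (L.resolvent z)
    rw [← hx, ← hw, ← hxy, ← hwz, inner_add_left, inner_add_right, L.symm]
  · obtain ⟨x, hx, hxy⟩ := L.resolvent_spec y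
    have h := (sq_nonneg ‖(x : H)‖).trans (L.norm_sq_le x)
    rw [hxy, hx] at h
    rw [ContinuousLinearMap.reApplyInnerSelf_apply, inner_re_symm]
    exact h

theorem range_resolvent (L : NonnegSelfAdjoint H) (x : L.op.domain) :
    L.resolvent ((x : H) + L.op x) = x := by
  obtain ⟨w, hw, hwz⟩ := L.resolvent_spec ((x : H) + L.op x)
  rw [← hw, L.oneAdd_injective (a₁ := w) (a₂ := x) hwz]

theorem spectrum_resolvent (L : NonnegSelfAdjoint H) {z : ℂ} (hz : z ∈ spectrum ℂ L.resolvent) :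
    z = (z.re : ℂ) ∧ 0 ≤ z.re ∧ z.re ≤ 1 := by
  have hsa := L.resolvent_nonneg.isSelfAdjoint
  have h1 := hsa.mem_spectrum_eq_re hz
  refine ⟨h1, ?_, ?_⟩
  · have h2 : z.re ∈ spectrum ℝ L.resolvent := by
      rw [h1] at hz
      exact spectrum.of_algebraMap_mem ℂ hz
    have h3 : (0 : H →L[ℂ] H) ≤ L.resolvent :=
      (ContinuousLinearMap.nonneg_iff_isPositive _).mpr L.resolvent_nonneg
    exact spectrum_nonneg_of_nonneg h3 h2
  · have h4 : ‖z‖ ≤ 1 := by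
      rcases subsingleton_or_nontrivial H with hH | hH
      · have : Subsingleton (H →L[ℂ] H) := inferInstance
        rw [spectrum.of_subsingleton] at hz
        exact hz.elim
      · exact (spectrum.norm_le_norm_of_mem hz).trans L.norm_resolvent_le
    exact (Complex.re_le_norm z).trans h4

/-- The operator `F(L)` for `F` continuous on `[0, ∞)` and vanishing at infinity. If `E_L` is the
spectral resolution of `L`, then `F(L) = ∫ F(λ) dE_L(λ)` is the function
`a ↦ F (1 / a - 1)`, extended by its limit `0` to `a = 0`, of the bounded self-adjoint operator
`(1 + L)⁻¹`, whose spectrum lies in `[0, 1]`; that function of a bounded operator is given by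
Mathlib's continuous functional calculus `cfc`. -/
def funcCalc (L : NonnegSelfAdjoint H) (F : ℝ → ℂ) : H →L[ℂ] H :=
  cfc (fun z : ℂ => if z = 0 then 0 else F (z.re⁻¹ - 1)) L.resolvent

/-- The functions to which `funcCalc` is applied are continuous on the spectrum. -/
theorem continuousOn_funcCalc (L : NonnegSelfAdjoint H) {F : ℝ → ℂ} (hF : Continuous F)
    (h0 : Tendsto F atTop (𝓝 0)) :
    ContinuousOn (fun z : ℂ => if z = 0 then 0 else F (z.re⁻¹ - 1))
      (spectrum ℂ L.resolvent) := by
  intro z hz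
  obtain ⟨hz1, hz2, -⟩ := L.spectrum_resolvent hz
  by_cases h : z = 0
  · subst h
    rw [ContinuousWithinAt]
    simp only [if_true]
    rw [Metric.tendsto_nhdsWithin_nhds]
    intro ε hε
    obtain ⟨N, hN⟩ := Metric.tendsto_atTop.mp h0 ε hε
    refine ⟨(|N| + 2)⁻¹, by positivity, fun {w} hw hwd => ?_⟩
    obtain ⟨hw1, hw2, -⟩ := L.spectrum_resolvent hw
    by_cases hw0 : w = 0
    · simpa [hw0] using hε
    · rw [if_neg hw0]
      apply hN
      have hpos : 0 < w.re := lt_of_le_of_ne hw2 fun h => hw0 (by rw [hw1, ← h]; simp)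
      have hlt : w.re < (|N| + 2)⁻¹ :=
        lt_of_le_of_lt (Complex.re_le_norm w) (by simpa [dist_eq_norm] using hwd)
      have := (lt_inv_comm₀ hpos (by positivity)).mp hlt
      linarith [le_abs_self N]
  · have hre : z.re ≠ 0 := fun h' => h (by rw [hz1, h']; simp)
    have hc : ContinuousAt (fun z : ℂ => F (z.re⁻¹ - 1)) z :=
      hF.continuousAt.comp
        ((Complex.continuous_re.continuousAt.inv₀ hre).sub continuousAt_const)
    refine (hc.congr ?_).continuousWithinAt
    filter_upwards [isOpen_ne.mem_nhds h] with w hw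
    rw [if_neg hw]

/-- The semigroup `e^{-tL}`, `t > 0`. -/
def heat (L : NonnegSelfAdjoint H) (t : ℝ) : H →L[ℂ] H :=
  L.funcCalc fun l => (Real.exp (-(t * l)) : ℂ)

/-- The operator `e^{-(ε - it)L}` for `ε > 0` and real `t`. -/
def complexHeat (L : NonnegSelfAdjoint H) (t ε : ℝ) : H →L[ℂ] H :=
  L.funcCalc fun l => Complex.exp (-((ε - Complex.I * t) * l))

theorem complexHeat_factor (t ε l : ℝ) : Complex.exp (-((ε - Complex.I * t) * l)) =
    Complex.exp ((t * l : ℝ) * Complex.I) * (Real.exp (-(ε * l)) : ℂ) := by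
  rw [Complex.ofReal_exp, ← Complex.exp_add]
  congr 1
  push_cast
  ring

theorem norm_complexHeat_symbol (t ε l : ℝ) :
    ‖Complex.exp (-((ε - Complex.I * t) * l))‖ = Real.exp (-(ε * l)) := by
  rw [complexHeat_factor, norm_mul, Complex.norm_exp_ofReal_mul_I, one_mul, Complex.norm_real,
    Real.norm_of_nonneg (Real.exp_pos _).le]

theorem continuous_complexHeat_symbol (t ε : ℝ) :
    Continuous fun l : ℝ => Complex.exp (-((ε - Complex.I * t) * l)) := by fun_prop

theorem tendsto_complexHeat_symbol (t : ℝ) {ε : ℝ} (hε : 0 < ε) :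
    Tendsto (fun l : ℝ => Complex.exp (-((ε - Complex.I * t) * l))) atTop (𝓝 0) := by
  rw [tendsto_zero_iff_norm_tendsto_zero]
  simp only [norm_complexHeat_symbol]
  exact Real.tendsto_exp_neg_atTop_nhds_zero.comp (tendsto_id.const_mul_atTop hε)

theorem norm_complexHeat_le (L : NonnegSelfAdjoint H) (t : ℝ) {ε : ℝ} (hε : 0 < ε) :
    ‖L.complexHeat t ε‖ ≤ 1 := by
  refine norm_cfc_le zero_le_one fun z hz => ?_
  obtain ⟨hz1, hz2, hz3⟩ := L.spectrum_resolvent hz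
  by_cases h : z = 0
  · simp [h]
  · have hpos : 0 < z.re := lt_of_le_of_ne hz2 fun h' => h (by rw [hz1, ← h']; simp)
    rw [if_neg h, norm_complexHeat_symbol, Real.exp_le_one_iff]
    have : 0 ≤ z.re⁻¹ - 1 := sub_nonneg.mpr ((one_le_inv₀ hpos).mpr hz3)
    nlinarith [mul_nonneg hε.le this]

theorem norm_complexHeat_sub_le (L : NonnegSelfAdjoint H) (t : ℝ) {ε δ : ℝ} (hε : 0 < ε)
    (hδ : 0 < δ) :
    ‖(L.complexHeat t ε - L.complexHeat t δ) * L.resolvent‖ ≤ |ε - δ| := by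
  have hA : IsStarNormal L.resolvent := L.resolvent_nonneg.isSelfAdjoint.isStarNormal
  have c1 := L.continuousOn_funcCalc (continuous_complexHeat_symbol t ε)
    (tendsto_complexHeat_symbol t hε)
  have c2 := L.continuousOn_funcCalc (continuous_complexHeat_symbol t δ)
    (tendsto_complexHeat_symbol t hδ)
  have hid : L.resolvent = cfc (fun z : ℂ => z) L.resolvent := (cfc_id' ℂ L.resolvent).symm
  rw [complexHeat, complexHeat, funcCalc, funcCalc, ← cfc_sub _ _ _ c1 c2]
  conv_lhs => enter [1, 2]; rw [hid]
  have c3 := ContinuousOn.sub c1 c2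
  rw [Pi.sub_def] at c3
  have c4 : ContinuousOn (fun z : ℂ => z) (spectrum ℂ L.resolvent) := continuousOn_id
  rw [← cfc_mul _ _ _ c3 c4]
  refine norm_cfc_le (abs_nonneg _) fun z hz => ?_
  obtain ⟨hz1, hz2, hz3⟩ := L.spectrum_resolvent hz
  by_cases h : z = 0
  · simp [h]
  · have hpos : 0 < z.re := lt_of_le_of_ne hz2 fun h' => h (by rw [hz1, ← h']; simp)
    have hl : 0 ≤ z.re⁻¹ - 1 := sub_nonneg.mpr ((one_le_inv₀ hpos).mpr hz3)
    have hzn : ‖z‖ = z.re := by rw [hz1]; simp [abs_of_nonneg hz2]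
    simp only [if_neg h]
    rw [complexHeat_factor, complexHeat_factor, ← mul_sub, norm_mul, norm_mul,
      Complex.norm_exp_ofReal_mul_I, one_mul, ← Complex.ofReal_sub, Complex.norm_real, hzn,
      Real.norm_eq_abs]
    set l := z.re⁻¹ - 1 with hldef
    have hzl : z.re * l ≤ 1 := by
      rw [hldef, mul_sub, mul_inv_cancel₀ hpos.ne']; linarith
    have key : ∀ a b : ℝ, 0 < a → a ≤ b →
        |Real.exp (-(a * l)) - Real.exp (-(b * l))| ≤ (b - a) * l := by
      intro a b ha hab
      have e1 : Real.exp (-(b * l)) = Real.exp (-(a * l)) * Real.exp (-((b - a) * l)) := by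
        rw [← Real.exp_add]; congr 1; ring
      have e2 := Real.add_one_le_exp (-((b - a) * l))
      have e3 : Real.exp (-(a * l)) ≤ 1 :=
        Real.exp_le_one_iff.mpr (neg_nonpos.mpr (mul_nonneg ha.le hl))
      have e4 := Real.exp_pos (-(a * l))
      have e5 : 0 ≤ (b - a) * l := mul_nonneg (sub_nonneg.mpr hab) hl
      have e6 : Real.exp (-((b - a) * l)) ≤ 1 := Real.exp_le_one_iff.mpr (neg_nonpos.mpr e5)
      rw [e1, abs_of_nonneg (by nlinarith)]
      nlinarith
    have hkey : |Real.exp (-(ε * l)) - Real.exp (-(δ * l))| ≤ |ε - δ| * l := by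
      rcases le_total ε δ with hle | hle
      · rw [abs_sub_comm ε δ, abs_of_nonneg (sub_nonneg.mpr hle)]
        exact key ε δ hε hle
      · rw [abs_sub_comm, abs_of_nonneg (sub_nonneg.mpr hle)]
        exact key δ ε hδ hle
    calc _ ≤ |ε - δ| * l * z.re := mul_le_mul_of_nonneg_right hkey hz2
      _ = |ε - δ| * (z.re * l) := by ring
      _ ≤ |ε - δ| * 1 := mul_le_mul_of_nonneg_left hzl (abs_nonneg _)
      _ = _ := mul_one _

/-- The strong limit of `e^{-(ε - it)L}` as `ε → 0+` exists. -/
theorem exists_tendsto_complexHeat (L : NonnegSelfAdjoint H) (t : ℝ) (f : H) :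
    ∃ g : H, Tendsto (fun ε => L.complexHeat t ε f) (𝓝[>] 0) (𝓝 g) := by
  apply CompleteSpace.complete (f := map (fun ε => L.complexHeat t ε f) (𝓝[>] 0))
  rw [Metric.cauchy_iff]
  refine ⟨inferInstance, fun η hη => ?_⟩
  obtain ⟨x, hx, hfx⟩ := Metric.mem_closure_iff.mp (L.selfAdjoint.dense_domain f) (η / 4)
    (by positivity)
  set y : H := x + L.op ⟨x, hx⟩ with hy
  have hAy : L.resolvent y = x := L.range_resolvent ⟨x, hx⟩
  set r : ℝ := η / (4 * (‖y‖ + 1)) with hr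
  have hrpos : 0 < r := by positivity
  refine ⟨_, image_mem_map (Ioo_mem_nhdsGT hrpos), ?_⟩
  rintro _ ⟨ε, ⟨hε, hεr⟩, rfl⟩ _ ⟨δ, ⟨hδ, hδr⟩, rfl⟩
  have h1 : ∀ ε : ℝ, 0 < ε → ‖L.complexHeat t ε (f - x)‖ ≤ η / 4 := fun ε hε => by
    refine ((L.complexHeat t ε).le_of_opNorm_le (L.norm_complexHeat_le t hε) _).trans ?_
    rw [one_mul, ← dist_eq_norm]
    exact hfx.le
  have h2 : ‖L.complexHeat t ε x - L.complexHeat t δ x‖ ≤ η / 4 := by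
    have := ContinuousLinearMap.le_of_opNorm_le _ (L.norm_complexHeat_sub_le t hε hδ) y
    rw [mul_apply_eq_comp, hAy, sub_apply] at this
    refine this.trans ?_
    have h3 : |ε - δ| ≤ r := abs_sub_le_iff.mpr ⟨by linarith, by linarith⟩
    calc |ε - δ| * ‖y‖ ≤ r * (‖y‖ + 1) := by gcongr; linarith
      _ = η / 4 := by rw [hr]; field_simp
  have h4 : L.complexHeat t ε f - L.complexHeat t δ f = L.complexHeat t ε (f - x)
      - L.complexHeat t δ (f - x) + (L.complexHeat t ε x - L.complexHeat t δ x) := by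
    rw [map_sub, map_sub]; abel
  rw [dist_eq_norm, h4]
  calc _ ≤ η / 4 + η / 4 + η / 4 :=
        (norm_add_le _ _).trans (add_le_add ((norm_sub_le _ _).trans
          (add_le_add (h1 ε hε) (h1 δ hδ))) h2)
    _ < η := by linarith

/-- The Schrödinger group `e^{itL}`, the strong limit of `e^{-(ε - it)L}` as `ε → 0+`. -/
def schrodinger (L : NonnegSelfAdjoint H) (t : ℝ) : H →L[ℂ] H :=
  continuousLinearMapOfTendsto (l := 𝓝[>] (0 : ℝ)) (fun ε => L.complexHeat t ε)
    (tendsto_pi_nhds.mpr fun f => (L.exists_tendsto_complexHeat t f).choose_spec)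

theorem tendsto_schrodinger (L : NonnegSelfAdjoint H) (t : ℝ) (f : H) :
    Tendsto (fun ε => L.complexHeat t ε f) (𝓝[>] 0) (𝓝 (L.schrodinger t f)) :=
  (L.exists_tendsto_complexHeat t f).choose_spec

end NonnegSelfAdjoint

end Calculus

section MetricMeasure

variable {X : Type*} [MeasurableSpace X]

/-- The function `χ_E f` as an element of `L²(X, μ)`. -/
def cutoffFun (μ : Measure X) {E : Set X} (hE : MeasurableSet E) (f : Lp ℂ 2 μ) : Lp ℂ 2 μ :=
  ((Lp.memLp f).indicator hE).toLp (E.indicator f)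

theorem coeFn_cutoffFun (μ : Measure X) {E : Set X} (hE : MeasurableSet E) (f : Lp ℂ 2 μ) :
    cutoffFun μ hE f =ᵐ[μ] E.indicator f :=
  MemLp.coeFn_toLp _

/-- The operator `P_E` on `L²(X, μ)` of multiplication by the characteristic function of `E`. -/
def cutoff (μ : Measure X) {E : Set X} (hE : MeasurableSet E) : Lp ℂ 2 μ →L[ℂ] Lp ℂ 2 μ :=
  LinearMap.mkContinuous
    { toFun := cutoffFun μ hE
      map_add' := fun f g => by
        apply Lp.ext
        filter_upwards [coeFn_cutoffFun μ hE (f + g), coeFn_cutoffFun μ hE f,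
          coeFn_cutoffFun μ hE g, Lp.coeFn_add f g,
          Lp.coeFn_add (cutoffFun μ hE f) (cutoffFun μ hE g)] with x h1 h2 h3 h4 h5
        rw [h1, h5, Pi.add_apply, h2, h3]
        by_cases h : x ∈ E
        · rw [Set.indicator_of_mem h, Set.indicator_of_mem h, Set.indicator_of_mem h, h4,
            Pi.add_apply]
        · rw [Set.indicator_of_notMem h, Set.indicator_of_notMem h, Set.indicator_of_notMem h,
            add_zero]
      map_smul' := fun a f => by
        apply Lp.ext
        rw [RingHom.id_apply]
        filter_upwards [coeFn_cutoffFun μ hE (a • f), coeFn_cutoffFun μ hE f,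
          Lp.coeFn_smul a f, Lp.coeFn_smul a (cutoffFun μ hE f)] with x h1 h2 h3 h4
        rw [h1, h4, Pi.smul_apply, h2]
        by_cases h : x ∈ E
        · rw [Set.indicator_of_mem h, Set.indicator_of_mem h, h3, Pi.smul_apply]
        · rw [Set.indicator_of_notMem h, Set.indicator_of_notMem h, smul_zero] }
    1 (fun f => by
      rw [one_mul]
      apply Lp.norm_le_norm_of_ae_le
      filter_upwards [coeFn_cutoffFun μ hE f] with x hx
      rw [LinearMap.coe_mk, AddHom.coe_mk, hx]
      exact norm_indicator_le_norm_self _ _)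

variable [MetricSpace X] [BorelSpace X]

/-- `(X, d, μ)` is a space of homogeneous type with dimension `n` and constant `A`:
balls have positive finite measure and `V(x, λr) ≤ A λ^n V(x, r)` for all `λ ≥ 1`. -/
structure HomogeneousType (μ : Measure X) (A n : ℝ) : Prop where
  pos : ∀ (x : X) (r : ℝ), 0 < r → 0 < μ (Metric.ball x r)
  finite : ∀ (x : X) (r : ℝ), 0 < r → μ (Metric.ball x r) < ⊤
  growth : ∀ (x : X) (r l : ℝ), 0 < r → 1 ≤ l →
    μ (Metric.ball x (l * r)) ≤ ENNReal.ofReal (A * l ^ n) * μ (Metric.ball x r)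

/-- The operator `P_B` for the ball `B = B(x, r)`. -/
def ballCutoff (μ : Measure X) (x : X) (r : ℝ) : Lp ℂ 2 μ →L[ℂ] Lp ℂ 2 μ :=
  cutoff μ (E := Metric.ball x r) Metric.isOpen_ball.measurableSet

/-- The `m`-th order Davies–Gaffney estimates with constants `C` and `c`. -/
def DaviesGaffney {μ : Measure X} (L : NonnegSelfAdjoint (Lp ℂ 2 μ)) (m C c : ℝ) : Prop :=
  ∀ t : ℝ, 0 < t → ∀ x y : X,
    ‖ballCutoff μ x (t ^ (1 / m)) * L.heat t * ballCutoff μ y (t ^ (1 / m))‖ ≤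
      C * Real.exp (-(c * (dist x y / t ^ (1 / m)) ^ (m / (m - 1))))

/-- The distance `inf {d(x, y) : x ∈ E, y ∈ F}` between two non-empty sets. -/
def setDist (E F : Set X) : ℝ := sInf (Set.image2 dist E F)

end MetricMeasure

end OffDiag

end

/-!
Write `τ = 2^{-k} t`, `ρ = τ^{1/m}` and `R = 2^k`, so that the length scale of the estimate is
`2^{(m-1)k/m} t^{1/m} = R ρ`. The decay is read off from iterated commutators: if `e` is
multiplication by the distance to the first ball `B₁`, truncated at `D = d(B₁, B₂)` and divided by
`ρ`, then `e` vanishes on `B₁` and equals `D / ρ` on `B₂`, so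
`P_{B₁} (ad_e^N T) P_{B₂} = (-D / ρ)^N P_{B₁} T P_{B₂}` for every bounded operator `T`. It is
enough to show that `‖ad_e^N T‖ ≤ C R^N` for `T = (1 - e^{-sL})^K e^{itL} φ(τL)`. No estimate of the
semigroup at complex times is needed, and the balls may be replaced by arbitrary sets.

* `exists_commBound_of_offDiagonal`: the commutators of `e^{-τL}` are bounded. The space is cut into
  cells of size `ρ` around a maximal separated set; on the block of two cells at distance `d` a
  commutator with `e` costs a factor `2 + d / ρ`, which the Davies–Gaffney factor absorbs, and the
  blocks are summed by Schur's test (`Resolution.norm_le_of_schur`) and the growth of volumes.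
* `exists_commBound_funcCalc`: the commutators of `ζ(τL)` are bounded for each test function `ζ` on
  `(0, ∞)`. With `v = e^{-u}` one has `ζ(u) = h(v)`, where `h` is smooth with compact support in
  `(0, 1)`; its Fourier series expresses `ζ(τL)` through the powers of `e^{2πi e^{-τL}}`, whose
  commutators grow polynomially because they are unitary (`CommBound.pow`).
* On the support of `φ` the operator `τL` may be replaced by the bounded operator `B = ψ(τL)`, where
  `ψ ≥ 1/8` is smooth, constant off a compact set, and `ψ(u) = u` on `[1/4, 4]`. Hence
  `T = φ(τL) (1 - e^{-σB})^K e^{iRB}` with `σ = s / τ` (`semiconjBy_exp_truncated`,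
  `semiconjBy_schrodinger`).
* `e^{iRB}` is the `R`-th power of a unitary with bounded commutators, so its commutators of order
  `a` are `O(R^a)` (`commBound_exp_I_mul`). For `e^{-σB}` the polynomial growth in `σ` is offset by
  `‖e^{-σB}‖ ≤ e^{-σ/8}`, which makes the bounds uniform in `s`
  (`exists_commBound_exp_neg_truncated`).
-/

namespace OffDiag

/-! ### Iterated commutators -/

section Commutators

variable {𝔸 : Type*} [NormedRing 𝔸] [NormedAlgebra ℂ 𝔸]

/-- The derivation `X ↦ e X - X e` of the Banach algebra `𝔸`. -/
noncomputable def comm (e : 𝔸) : 𝔸 →L[ℂ] 𝔸 :=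
  ContinuousLinearMap.mul ℂ 𝔸 e - (ContinuousLinearMap.mul ℂ 𝔸).flip e

theorem comm_apply (e X : 𝔸) : comm e X = e * X - X * e := by
  simp [comm]

theorem comm_mul (e X Y : 𝔸) : comm e (X * Y) = comm e X * Y + X * comm e Y := by
  simp only [comm_apply]; noncomm_ring

/-- The iterated commutators of `X` with `e` up to order `N` are at most those of a geometric
sequence, `‖ad_e^a X‖ ≤ q b ^ a`. Here `q` controls the operator norm and `b` is the
distance over which `X` spreads. -/
def CommBound (e : 𝔸) (N : ℕ) (X : 𝔸) (q b : ℝ) : Prop :=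
  ∀ a ≤ N, ‖(comm e ^ a) X‖ ≤ q * b ^ a

namespace CommBound

variable {e X Y : 𝔸} {N : ℕ} {q b q' b' : ℝ}

theorem norm_le (h : CommBound e N X q b) : ‖X‖ ≤ q := by
  simpa using h 0 (Nat.zero_le _)

theorem nonneg (h : CommBound e N X q b) : 0 ≤ q := (norm_nonneg X).trans h.norm_le

theorem mono (h : CommBound e N X q b) (hb : 0 ≤ b) (hq : q ≤ q') (hbb : b ≤ b') :
    CommBound e N X q' b' := fun a ha =>
  (h a ha).trans (mul_le_mul hq (pow_le_pow_left₀ hb hbb a) (by positivity) (h.nonneg.trans hq))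

theorem add (h : CommBound e N X q b) (h' : CommBound e N Y q' b) :
    CommBound e N (X + Y) (q + q') b := fun a ha => by
  rw [map_add, add_mul]
  exact (norm_add_le _ _).trans (add_le_add (h a ha) (h' a ha))

theorem smul (h : CommBound e N X q b) (z : ℂ) : CommBound e N (z • X) (‖z‖ * q) b :=
  fun a ha => by
    rw [map_smul, norm_smul, mul_assoc]
    exact mul_le_mul_of_nonneg_left (h a ha) (norm_nonneg z)

theorem comm_left (h : CommBound e (N + 1) X q b) : CommBound e N (comm e X) (q * b) b :=
  fun a ha => by
    have := h (a + 1) (by omega)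
    rw [pow_succ, mul_apply_eq_comp] at this
    rw [mul_assoc, ← pow_succ']
    exact this

theorem of_comm (h0 : ‖X‖ ≤ q) (h : CommBound e N (comm e X) (q * b) b) :
    CommBound e (N + 1) X q b := fun a ha => by
  cases a with
  | zero => simpa using h0
  | succ a =>
    rw [pow_succ, mul_apply_eq_comp, pow_succ', ← mul_assoc]
    exact h a (by omega)

/-- The Leibniz rule and the binomial theorem, in one induction on the order. -/
theorem mul (h : CommBound e N X q b) (h' : CommBound e N Y q' b') :
    CommBound e N (X * Y) (q * q') (b + b') := by
  induction N generalizing X Y q q' with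
  | zero =>
    intro a ha
    obtain rfl : a = 0 := by omega
    simpa using (norm_mul_le X Y).trans
      (mul_le_mul h.norm_le h'.norm_le (norm_nonneg _) h.nonneg)
  | succ N ih =>
    have hX : CommBound e N X q b := fun a ha => h a (by omega)
    have hY : CommBound e N Y q' b' := fun a ha => h' a (by omega)
    refine of_comm ?_ ?_
    · exact (norm_mul_le X Y).trans (mul_le_mul h.norm_le h'.norm_le (norm_nonneg _) h.nonneg)
    · rw [comm_mul]
      have := (ih h.comm_left hY).add (ih hX h'.comm_left)
      convert! this using 1
      ring

theorem one [NormOneClass 𝔸] (e : 𝔸) (N : ℕ) : CommBound e N 1 1 0 := by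
  cases N with
  | zero =>
    intro a ha
    obtain rfl : a = 0 := by omega
    simp
  | succ N =>
    refine of_comm (by simp) fun a _ => ?_
    rw [comm_apply, mul_one, one_mul, sub_self, map_zero]
    simp

theorem pow [NormOneClass 𝔸] (h : CommBound e N X q b) (n : ℕ) :
    CommBound e N (X ^ n) (q ^ n) (n * b) := by
  induction n with
  | zero => simpa using one e N
  | succ n ih =>
    rw [pow_succ, pow_succ]
    convert! ih.mul h using 1
    push_cast; ring

/-- The operator norm alone determines the admissible `q`, at the price of a larger `b`. -/
theorem of_norm_le (h : CommBound e N X q b) (hb : 0 ≤ b) {p : ℝ} (hp : 0 < p) (hX : ‖X‖ ≤ p) :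
    CommBound e N X p ((1 + q / p) * b) := by
  intro a ha
  rcases Nat.eq_zero_or_pos a with rfl | h0
  · simpa using hX
  have hq : 0 ≤ q / p := div_nonneg h.nonneg hp.le
  refine (h a ha).trans ?_
  rw [mul_pow, ← mul_assoc]
  refine mul_le_mul_of_nonneg_right ?_ (by positivity)
  calc q = p * (q / p) := by field_simp
    _ ≤ p * (1 + q / p) ^ a := by
      refine mul_le_mul_of_nonneg_left ?_ hp.le
      calc q / p ≤ 1 + q / p := by linarith
        _ ≤ _ := le_self_pow₀ (by linarith) h0.ne'

theorem exp [NormOneClass 𝔸] [CompleteSpace 𝔸] (h : CommBound e N X q b) (hb : 0 ≤ b) :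
    CommBound e N (NormedSpace.exp X) (Real.exp (q * Real.exp 1) * N.factorial) b := by
  intro a ha
  have hs : HasSum (fun n : ℕ => (comm e ^ a) ((n.factorial⁻¹ : ℂ) • X ^ n))
      ((comm e ^ a) (NormedSpace.exp X)) :=
    (NormedSpace.exp_series_hasSum_exp' (𝕂 := ℂ) X).mapL (comm e ^ a)
  have hr : HasSum (fun n : ℕ => (a.factorial * b ^ a) * ((q * Real.exp 1) ^ n / n.factorial))
      ((a.factorial * b ^ a) * Real.exp (q * Real.exp 1)) := by
    refine HasSum.mul_left _ ?_
    rw [Real.exp_eq_exp_ℝ]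
    exact NormedSpace.expSeries_div_hasSum_exp _
  refine (hs.norm_le_of_bounded hr fun n => ?_).trans ?_
  · have h1 := h.pow n a ha
    have h2 : (n : ℝ) ^ a ≤ a.factorial * Real.exp 1 ^ n := by
      have := Real.pow_div_factorial_le_exp n (Nat.cast_nonneg n) a
      rw [div_le_iff₀ (by positivity)] at this
      rw [← Real.exp_nat_mul, mul_one, mul_comm]
      exact this
    have hq := h.nonneg
    rw [map_smul, norm_smul]
    have h3 : ‖((n.factorial : ℂ)⁻¹)‖ = (n.factorial : ℝ)⁻¹ := by simp
    rw [h3]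
    calc (n.factorial : ℝ)⁻¹ * ‖(comm e ^ a) (X ^ n)‖
        ≤ (n.factorial : ℝ)⁻¹ * (q ^ n * (n * b) ^ a) := by gcongr
      _ = (n.factorial : ℝ)⁻¹ * (q ^ n * (n ^ a * b ^ a)) := by rw [mul_pow]
      _ ≤ (n.factorial : ℝ)⁻¹ * (q ^ n * (a.factorial * Real.exp 1 ^ n * b ^ a)) := by gcongr
      _ = _ := by rw [mul_pow]; ring
  · have h4 : (a.factorial : ℝ) ≤ N.factorial := by exact_mod_cast Nat.factorial_le ha
    calc (a.factorial * b ^ a) * Real.exp (q * Real.exp 1)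
        ≤ (N.factorial * b ^ a) * Real.exp (q * Real.exp 1) := by gcongr
      _ = _ := by ring

/-- A summable combination of elements with polynomially growing bounds. -/
theorem of_hasSum {ι : Type*} {V : ι → 𝔸} {c : ι → ℂ} {w : ι → ℝ}
    (hV : ∀ i, CommBound e N (V i) 1 (b * w i)) (hb : 0 ≤ b) (hw : ∀ i, 0 ≤ w i)
    (hc : Summable fun i => ‖c i‖ * (1 + w i) ^ N) (hX : HasSum (fun i => c i • V i) X) :
    CommBound e N X (∑' i, ‖c i‖ * (1 + w i) ^ N) b := by
  intro a ha
  refine (hX.mapL (comm e ^ a)).norm_le_of_bounded (hc.hasSum.mul_right (b ^ a)) fun i => ?_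
  rw [map_smul, norm_smul, mul_assoc]
  refine mul_le_mul_of_nonneg_left ((hV i a ha).trans ?_) (norm_nonneg _)
  rw [one_mul, mul_pow, mul_comm]
  refine mul_le_mul_of_nonneg_right ?_ (by positivity)
  calc w i ^ a ≤ (1 + w i) ^ a := pow_le_pow_left₀ (hw i) (by linarith) a
    _ ≤ _ := pow_le_pow_right₀ (by linarith [hw i]) ha

end CommBound

/-- Replacing `e` by `e + c` does not change the commutators. -/
theorem comm_sub_smul_one (e : 𝔸) (c : ℂ) : comm (e - c • 1) = comm e := by
  ext X
  simp [comm_apply, sub_mul, mul_sub]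

/-- Elements commuting with `e` may be pulled out of iterated commutators with `e`. -/
theorem comm_pow_mul_mul {e P Q : 𝔸} (hP : Commute e P) (hQ : Commute e Q) (X : 𝔸) (a : ℕ) :
    (comm e ^ a) (P * X * Q) = P * (comm e ^ a) X * Q := by
  induction a generalizing X with
  | zero => simp
  | succ a ih =>
    rw [pow_succ, mul_apply_eq_comp, mul_apply_eq_comp, ← ih]
    congr 1
    simp only [comm_apply, mul_sub, sub_mul]
    rw [mul_assoc _ Q e, ← hQ.eq, ← mul_assoc, ← mul_assoc, hP.eq]
    simp only [mul_assoc]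

/-- If `e` is close to a constant `c` on the ranges of `P` and of `Q`, then the commutators of the
block `P X Q` with `e` are small. -/
theorem norm_comm_pow_block_le {e P Q : 𝔸} (hP : Commute e P) (hQ : Commute e Q)
    (hPP : P * P = P) (hQQ : Q * Q = Q) (c : ℂ) {u v : ℝ} (hu : ‖(e - c • 1) * P‖ ≤ u)
    (hv : ‖Q * (e - c • 1)‖ ≤ v) (X : 𝔸) (a : ℕ) :
    ‖P * (comm e ^ a) X * Q‖ ≤ (u + v) ^ a * ‖P * X * Q‖ := by
  induction a generalizing X with
  | zero => simp
  | succ a ih =>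
    have huv : 0 ≤ u + v := add_nonneg ((norm_nonneg _).trans hu) ((norm_nonneg _).trans hv)
    rw [pow_succ, mul_apply_eq_comp]
    refine (ih _).trans ?_
    rw [pow_succ, mul_assoc ((u + v) ^ a)]
    refine mul_le_mul_of_nonneg_left ?_ (pow_nonneg huv a)
    have h1 : P * comm e X * Q
        = (e - c • 1) * P * (P * X * Q) - (P * X * Q) * (Q * (e - c • 1)) := by
      have hP' : Commute (e - c • 1) P := hP.sub_left ((Commute.one_left P).smul_left c)
      have hQ' : Commute (e - c • 1) Q := hQ.sub_left ((Commute.one_left Q).smul_left c)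
      have := comm_pow_mul_mul hP' hQ' X 1
      rw [pow_one, comm_apply, comm_sub_smul_one] at this
      rw [← this, ← hQ'.eq]
      have e1 : P * (P * X * Q) = P * X * Q := by rw [← mul_assoc, ← mul_assoc, hPP]
      have e2 : P * X * Q * Q = P * X * Q := by rw [mul_assoc, hQQ]
      rw [mul_assoc (e - c • 1) P, e1, hQ'.eq, ← mul_assoc (P * X * Q) Q, e2]
    rw [h1, add_mul]
    refine (norm_sub_le _ _).trans (add_le_add ?_ ?_)
    · exact (norm_mul_le _ _).trans (mul_le_mul_of_nonneg_right hu (norm_nonneg _))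
    · rw [mul_comm v]
      exact (norm_mul_le _ _).trans (mul_le_mul_of_nonneg_left hv (norm_nonneg _))

/-- If `e` vanishes on the range of `P` and is the constant `D` on that of `Q`, then the block
`P X Q` is recovered from the commutators of `X` with `e`. -/
theorem comm_pow_block_eq {e P Q : 𝔸} {D : ℂ} (hP : P * e = 0) (hQ : e * Q = D • Q)
    (X : 𝔸) (a : ℕ) : P * (comm e ^ a) X * Q = (-D) ^ a • (P * X * Q) := by
  induction a generalizing X with
  | zero => simp
  | succ a ih =>
    rw [pow_succ, mul_apply_eq_comp, ih, pow_succ, mul_smul]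
    congr 1
    rw [comm_apply, mul_sub, sub_mul, ← mul_assoc, hP, zero_mul, zero_mul, zero_sub, mul_assoc,
      mul_assoc, hQ, mul_smul_comm, mul_smul_comm, neg_smul, mul_assoc]

end Commutators

/-! ### Schur's test for a resolution of the identity -/

section Schur

variable {H ι : Type*} [NormedAddCommGroup H] [InnerProductSpace ℂ H]

/-- A family of mutually orthogonal projections whose ranges span a dense subspace. -/
structure Resolution (P : ι → H →L[ℂ] H) : Prop where
  symm : ∀ i f g, inner ℂ (P i f) g = inner ℂ f (P i g)
  idem : ∀ i f, P i (P i f) = P i f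
  orth : ∀ i j, i ≠ j → ∀ f, P i (P j f) = 0
  total : ∀ f, (∀ i, P i f = 0) → f = 0

namespace Resolution

variable {P : ι → H →L[ℂ] H}

theorem inner_eq_zero (hP : Resolution P) {i j : ι} (hij : i ≠ j) (f g : H) :
    inner ℂ (P i f) (P j g) = 0 := by
  rw [hP.symm, hP.orth i j hij, inner_zero_right]

theorem sum_norm_sq_le (hP : Resolution P) (f : H) (F : Finset ι) :
    ∑ i ∈ F, ‖P i f‖ ^ 2 ≤ ‖f‖ ^ 2 := by
  classical
  have h1 : inner ℂ (∑ i ∈ F, P i f) f = ((∑ i ∈ F, ‖P i f‖ ^ 2 : ℝ) : ℂ) := by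
    rw [sum_inner, Complex.ofReal_sum]
    refine Finset.sum_congr rfl fun i _ => ?_
    rw [← hP.idem, hP.symm, inner_self_eq_norm_sq_to_K, hP.idem]
    simp
  have h2 : inner ℂ (∑ i ∈ F, P i f) (∑ i ∈ F, P i f) = ((∑ i ∈ F, ‖P i f‖ ^ 2 : ℝ) : ℂ) := by
    rw [sum_inner, Complex.ofReal_sum]
    refine Finset.sum_congr rfl fun i hi => ?_
    rw [inner_sum, Finset.sum_eq_single_of_mem i hi fun j _ hj => hP.inner_eq_zero hj.symm _ _,
      inner_self_eq_norm_sq_to_K]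
    simp
  set S := ∑ i ∈ F, ‖P i f‖ ^ 2
  set g := ∑ i ∈ F, P i f
  have hS : 0 ≤ S := Finset.sum_nonneg fun i _ => by positivity
  have h3 : ‖g‖ ^ 2 = S := by
    rw [inner_self_eq_norm_sq_to_K] at h2
    simp only [Complex.coe_algebraMap] at h2
    exact_mod_cast h2
  have h4 : S ≤ ‖g‖ * ‖f‖ := by
    have := norm_inner_le_norm (𝕜 := ℂ) g f
    rwa [h1, Complex.norm_real, Real.norm_of_nonneg hS] at this
  rw [← h3] at h4 ⊢
  rcases (norm_nonneg g).eq_or_lt with h0 | h0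
  · rw [← h0, zero_pow two_ne_zero]; positivity
  · have : ‖g‖ ≤ ‖f‖ := by nlinarith
    gcongr

theorem hasSum [CompleteSpace H] (hP : Resolution P) (f : H) : HasSum (fun i => P i f) f := by
  have hfam : OrthogonalFamily ℂ (fun i => LinearMap.range (P i).toLinearMap)
      (fun i => (LinearMap.range (P i).toLinearMap).subtypeₗᵢ) := by
    rintro i j hij ⟨_, x, rfl⟩ ⟨_, y, rfl⟩
    exact hP.inner_eq_zero hij x y
  have hs : Summable fun i => P i f := by
    refine (hfam.summable_iff_norm_sq_summable fun i => ⟨P i f, f, rfl⟩).mpr ?_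
    exact summable_of_sum_le (fun i => by positivity) (hP.sum_norm_sq_le f)
  obtain ⟨g, hg⟩ := hs
  have : f - g = 0 := hP.total _ fun i => by
    have h1 := hg.mapL (P i)
    have h2 : HasSum (fun j => P i (P j f)) (P i (P i f)) :=
      hasSum_single i fun j hj => hP.orth i j hj.symm f
    rw [map_sub, h1.unique h2, hP.idem, sub_self]
  rwa [← sub_eq_zero.mp this] at hg

/-- Schur's test: an operator whose blocks have norms summable along rows and columns. -/
theorem norm_le_of_schur [CompleteSpace H] (hP : Resolution P) (T : H →L[ℂ] H) {S : ℝ} (hS : 0 ≤ S)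
    (κ : ι → ι → ℝ) (hT : ∀ i j, ‖P i * T * P j‖ ≤ κ i j)
    (hrow : ∀ i (F : Finset ι), ∑ j ∈ F, κ i j ≤ S)
    (hcol : ∀ j (F : Finset ι), ∑ i ∈ F, κ i j ≤ S) : ‖T‖ ≤ S := by
  have key : ∀ f g : H, ‖inner ℂ (T f) g‖ ≤ S * ((‖f‖ ^ 2 + ‖g‖ ^ 2) / 2) := by
    intro f g
    have hlim : Tendsto (fun F : Finset ι => inner ℂ (T (∑ j ∈ F, P j f)) (∑ i ∈ F, P i g))
        atTop (𝓝 (inner ℂ (T f) g)) :=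
      ((T.continuous.tendsto f).comp (hP.hasSum f)).inner (hP.hasSum g)
    refine le_of_tendsto hlim.norm (Eventually.of_forall fun F => ?_)
    rw [map_sum, sum_inner]
    simp only [inner_sum]
    have hterm : ∀ j i, ‖inner ℂ (T (P j f)) (P i g)‖
        ≤ κ i j * ((‖P j f‖ ^ 2 + ‖P i g‖ ^ 2) / 2) := by
      intro j i
      have h1 : inner ℂ (T (P j f)) (P i g) = inner ℂ ((P i * T * P j) (P j f)) (P i g) := by
        rw [mul_apply_eq_comp, mul_apply_eq_comp, hP.idem, hP.symm,
          hP.idem]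
      rw [h1]
      have h2 := (norm_inner_le_norm (𝕜 := ℂ) ((P i * T * P j) (P j f)) (P i g)).trans
        (mul_le_mul_of_nonneg_right ((P i * T * P j).le_of_opNorm_le (hT i j) _) (norm_nonneg _))
      refine h2.trans ?_
      rw [mul_assoc]
      refine mul_le_mul_of_nonneg_left ?_ ((norm_nonneg _).trans (hT i j))
      nlinarith [sq_nonneg (‖P j f‖ - ‖P i g‖)]
    refine (norm_sum_le _ _).trans ((Finset.sum_le_sum fun j _ =>
      (norm_sum_le _ _).trans (Finset.sum_le_sum fun i _ => hterm j i)).trans ?_)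
    have h1 : ∑ j ∈ F, ∑ i ∈ F, κ i j * ((‖P j f‖ ^ 2 + ‖P i g‖ ^ 2) / 2)
        = (∑ j ∈ F, (∑ i ∈ F, κ i j) * ‖P j f‖ ^ 2
          + ∑ i ∈ F, (∑ j ∈ F, κ i j) * ‖P i g‖ ^ 2) / 2 := by
      simp only [Finset.sum_mul]
      rw [Finset.sum_comm (f := fun i j => κ i j * ‖P i g‖ ^ 2), ← Finset.sum_add_distrib,
        Finset.sum_div]
      refine Finset.sum_congr rfl fun j _ => ?_
      rw [← Finset.sum_add_distrib, Finset.sum_div]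
      exact Finset.sum_congr rfl fun i _ => by ring
    rw [h1]
    have h2 : ∑ j ∈ F, (∑ i ∈ F, κ i j) * ‖P j f‖ ^ 2 ≤ S * ‖f‖ ^ 2 := by
      calc _ ≤ ∑ j ∈ F, S * ‖P j f‖ ^ 2 :=
            Finset.sum_le_sum fun j _ => mul_le_mul_of_nonneg_right (hcol j F) (by positivity)
        _ = S * ∑ j ∈ F, ‖P j f‖ ^ 2 := (Finset.mul_sum _ _ _).symm
        _ ≤ _ := mul_le_mul_of_nonneg_left (hP.sum_norm_sq_le f F) hS
    have h3 : ∑ i ∈ F, (∑ j ∈ F, κ i j) * ‖P i g‖ ^ 2 ≤ S * ‖g‖ ^ 2 := by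
      calc _ ≤ ∑ i ∈ F, S * ‖P i g‖ ^ 2 :=
            Finset.sum_le_sum fun i _ => mul_le_mul_of_nonneg_right (hrow i F) (by positivity)
        _ = S * ∑ i ∈ F, ‖P i g‖ ^ 2 := (Finset.mul_sum _ _ _).symm
        _ ≤ _ := mul_le_mul_of_nonneg_left (hP.sum_norm_sq_le g F) hS
    linarith
  refine T.opNorm_le_bound hS fun f => ?_
  rcases (norm_nonneg (T f)).eq_or_lt with h0 | h0
  · rw [← h0]; positivity
  -- The vector `g` parallel to `T f` with `‖g‖ = ‖f‖`.
  set r : ℝ := ‖f‖ / ‖T f‖ with hr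
  have hr0 : 0 ≤ r := by positivity
  have hg : ‖(r : ℂ) • T f‖ = ‖f‖ := by
    rw [norm_smul, Complex.norm_real, Real.norm_of_nonneg hr0, hr]
    field_simp
  have h1 := key f ((r : ℂ) • T f)
  rw [hg, inner_smul_right, inner_self_eq_norm_sq_to_K, norm_mul, Complex.norm_real,
    Real.norm_of_nonneg hr0] at h1
  simp only [Complex.coe_algebraMap, norm_pow, Complex.norm_real, norm_norm] at h1
  have h2 : r * ‖T f‖ ^ 2 = ‖f‖ * ‖T f‖ := by rw [hr]; field_simp
  rw [h2] at h1
  rcases (norm_nonneg f).eq_or_lt with h3 | h3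
  · have : f = 0 := norm_eq_zero.mp h3.symm
    rw [this] at h0; simp at h0
  · nlinarith

end Resolution

end Schur

/-! ### Multiplication operators and cutoffs -/

section Multiplication

variable {X : Type*} [MeasurableSpace X] {μ : Measure X}

/-- Multiplication by an essentially bounded function, as an operator on `L²`. -/
noncomputable def mulOp (μ : Measure X) {g : X → ℂ} (hg : MemLp g ⊤ μ) :
    Lp ℂ 2 μ →L[ℂ] Lp ℂ 2 μ :=
  (ContinuousLinearMap.mul ℂ ℂ).holderL μ ⊤ 2 2 (hg.toLp g)

theorem coeFn_mulOp {g : X → ℂ} (hg : MemLp g ⊤ μ) (f : Lp ℂ 2 μ) :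
    mulOp μ hg f =ᵐ[μ] fun x => g x * f x := by
  have h := (ContinuousLinearMap.mul ℂ ℂ).coeFn_holder (r := 2) (hg.toLp g) f
  filter_upwards [h, hg.coeFn_toLp] with x h1 h2
  rw [← h2]
  exact h1

theorem coeFn_cutoff {E : Set X} (hE : MeasurableSet E) (f : Lp ℂ 2 μ) :
    cutoff μ hE f =ᵐ[μ] E.indicator f :=
  coeFn_cutoffFun μ hE f

theorem opNorm_le_of_ae {T : Lp ℂ 2 μ →L[ℂ] Lp ℂ 2 μ} {u : ℝ} (hu : 0 ≤ u)
    (h : ∀ f : Lp ℂ 2 μ, ∀ᵐ x ∂μ, ‖T f x‖ ≤ u * ‖f x‖) : ‖T‖ ≤ u :=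
  T.opNorm_le_bound hu fun f => Lp.norm_le_mul_norm_of_ae_le_mul (h f)

theorem norm_cutoff_le {E : Set X} (hE : MeasurableSet E) : ‖cutoff μ hE‖ ≤ 1 :=
  opNorm_le_of_ae zero_le_one fun f => by
    filter_upwards [coeFn_cutoff hE f] with x hx
    rw [hx, one_mul]
    exact norm_indicator_le_norm_self _ _

theorem cutoff_mul_cutoff {E F : Set X} (hE : MeasurableSet E) (hF : MeasurableSet F) :
    cutoff μ hE * cutoff μ hF = cutoff μ (hE.inter hF) := by
  ext1 f
  apply Lp.ext
  rw [mul_apply_eq_comp]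
  filter_upwards [coeFn_cutoff hE (cutoff μ hF f), coeFn_cutoff hF f,
    coeFn_cutoff (hE.inter hF) f] with x h1 h2 h3
  rw [h1, h3, ← Set.indicator_indicator]
  by_cases hx : x ∈ E
  · rw [Set.indicator_of_mem hx, Set.indicator_of_mem hx, h2]
  · rw [Set.indicator_of_notMem hx, Set.indicator_of_notMem hx]

theorem cutoff_mul_self {E : Set X} (hE : MeasurableSet E) :
    cutoff μ hE * cutoff μ hE = cutoff μ hE := by
  rw [cutoff_mul_cutoff]
  congr 1
  exact Set.inter_self E

theorem cutoff_mul_cutoff_of_subset {E F : Set X} (hE : MeasurableSet E) (hF : MeasurableSet F)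
    (h : E ⊆ F) : cutoff μ hE * cutoff μ hF = cutoff μ hE := by
  rw [cutoff_mul_cutoff]
  congr 1
  exact Set.inter_eq_left.mpr h

theorem cutoff_mul_cutoff_of_subset' {E F : Set X} (hE : MeasurableSet E) (hF : MeasurableSet F)
    (h : E ⊆ F) : cutoff μ hF * cutoff μ hE = cutoff μ hE := by
  rw [cutoff_mul_cutoff]
  congr 1
  exact Set.inter_eq_right.mpr h

theorem inner_cutoff {E : Set X} (hE : MeasurableSet E) (f g : Lp ℂ 2 μ) :
    inner ℂ (cutoff μ hE f) g = inner ℂ f (cutoff μ hE g) := by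
  rw [L2.inner_def, L2.inner_def]
  refine integral_congr_ae ?_
  filter_upwards [coeFn_cutoff hE f, coeFn_cutoff hE g] with x h1 h2
  rw [h1, h2]
  by_cases hx : x ∈ E
  · rw [Set.indicator_of_mem hx, Set.indicator_of_mem hx]
  · rw [Set.indicator_of_notMem hx, Set.indicator_of_notMem hx, inner_zero_left, inner_zero_right]

/-- The cutoffs to the members of a countable measurable partition resolve the identity. -/
theorem resolution_cutoff {ι : Type*} [Countable ι] {E : ι → Set X}
    (hE : ∀ i, MeasurableSet (E i)) (hd : ∀ i j, i ≠ j → Disjoint (E i) (E j))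
    (hc : ∀ x, ∃ i, x ∈ E i) : Resolution fun i => cutoff μ (hE i) where
  symm i f g := inner_cutoff (hE i) f g
  idem i f := by rw [← mul_apply_eq_comp, cutoff_mul_self]
  orth i j hij f := by
    rw [← mul_apply_eq_comp, cutoff_mul_cutoff]
    apply Lp.ext
    filter_upwards [coeFn_cutoff ((hE i).inter (hE j)) f, Lp.coeFn_zero ℂ 2 μ] with x h1 h2
    rw [h1, h2, Set.indicator_of_notMem]
    · rfl
    · rw [(hd i j hij).inter_eq]; exact Set.notMem_empty x
  total f h := by
    apply Lp.ext
    have h1 : ∀ᵐ x ∂μ, ∀ i, (E i).indicator f x = 0 := by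
      rw [ae_all_iff]
      intro i
      have h2 := coeFn_cutoff (hE i) f
      rw [h i] at h2
      filter_upwards [h2, Lp.coeFn_zero ℂ 2 μ] with x h3 h4
      rw [← h3, h4]; rfl
    filter_upwards [h1, Lp.coeFn_zero ℂ 2 μ] with x h2 h3
    obtain ⟨i, hi⟩ := hc x
    have := h2 i
    rw [Set.indicator_of_mem hi] at this
    rw [this, h3]; rfl

theorem commute_mulOp_cutoff {g : X → ℂ} (hg : MemLp g ⊤ μ) {E : Set X} (hE : MeasurableSet E) :
    Commute (mulOp μ hg) (cutoff μ hE) := by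
  rw [commute_iff_eq]
  ext1 f
  apply Lp.ext
  rw [mul_apply_eq_comp, mul_apply_eq_comp]
  filter_upwards [coeFn_mulOp hg (cutoff μ hE f), coeFn_cutoff hE f,
    coeFn_cutoff hE (mulOp μ hg f), coeFn_mulOp hg f] with x h1 h2 h3 h4
  rw [h1, h2, h3]
  by_cases hx : x ∈ E
  · rw [Set.indicator_of_mem hx, Set.indicator_of_mem hx, h4]
  · rw [Set.indicator_of_notMem hx, Set.indicator_of_notMem hx, mul_zero]

theorem norm_mulOp_sub_mul_cutoff_le {g : X → ℂ} (hg : MemLp g ⊤ μ) {E : Set X}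
    (hE : MeasurableSet E) (c : ℂ) {u : ℝ} (hu : 0 ≤ u) (h : ∀ x ∈ E, ‖g x - c‖ ≤ u) :
    ‖(mulOp μ hg - c • 1) * cutoff μ hE‖ ≤ u := by
  refine opNorm_le_of_ae hu fun f => ?_
  have h0 : ((mulOp μ hg - c • 1) * cutoff μ hE) f
      = mulOp μ hg (cutoff μ hE f) - c • cutoff μ hE f := by
    rw [mul_apply_eq_comp, sub_apply, smul_apply, one_apply_eq_self]
  rw [h0]
  filter_upwards [coeFn_mulOp hg (cutoff μ hE f), coeFn_cutoff hE f,
    Lp.coeFn_sub (mulOp μ hg (cutoff μ hE f)) (c • cutoff μ hE f),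
    Lp.coeFn_smul c (cutoff μ hE f)] with x h1 h2 h3 h4
  rw [h3, Pi.sub_apply, h1, h4, Pi.smul_apply, smul_eq_mul, ← sub_mul, norm_mul, h2]
  by_cases hx : x ∈ E
  · rw [Set.indicator_of_mem hx]
    exact mul_le_mul_of_nonneg_right (h x hx) (norm_nonneg _)
  · rw [Set.indicator_of_notMem hx, norm_zero, mul_zero]
    positivity

theorem mulOp_mul_cutoff_eq {g : X → ℂ} (hg : MemLp g ⊤ μ) {E : Set X}
    (hE : MeasurableSet E) (c : ℂ) (h : ∀ x ∈ E, g x = c) :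
    mulOp μ hg * cutoff μ hE = c • cutoff μ hE := by
  have := norm_mulOp_sub_mul_cutoff_le hg hE c le_rfl fun x hx => by rw [h x hx]; simp
  have := norm_le_zero_iff.mp this
  rwa [sub_mul, smul_one_mul, sub_eq_zero] at this

end Multiplication

/-! ### Separated nets in spaces of homogeneous type -/

section Nets

variable {X : Type*} [MeasurableSpace X] [MetricSpace X] [BorelSpace X] {μ : Measure X} {A n : ℝ}

/-- A `ρ`-separated set has boundedly many points at distance at most `l ρ` from a given point. -/
theorem HomogeneousType.card_le (hμ : HomogeneousType μ A n) (hA : 0 < A) {ρ l : ℝ}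
    (hρ : 0 < ρ) (hl : 0 ≤ l) (x : X) (F : Finset X)
    (hsep : (F : Set X).Pairwise fun y z => ρ ≤ dist y z) (hF : ∀ y ∈ F, dist y x ≤ l * ρ) :
    (F.card : ℝ) ≤ A * (4 * l + 2) ^ n := by
  set V := μ (Metric.ball x ((l + 1) * ρ)) with hV
  have hr : 0 < (l + 1) * ρ := by positivity
  have hV0 : V ≠ 0 := (hμ.pos x _ hr).ne'
  have hVt : V ≠ ⊤ := (hμ.finite x _ hr).ne
  have h1 : ∀ y ∈ F, V ≤ ENNReal.ofReal (A * (4 * l + 2) ^ n) * μ (Metric.ball y (ρ / 2)) := by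
    intro y hy
    refine le_trans (measure_mono ?_) (hμ.growth y (ρ / 2) (4 * l + 2) (by positivity)
      (by linarith))
    intro z hz
    rw [Metric.mem_ball] at hz ⊢
    have := dist_triangle z x y
    have h2 := hF y hy
    rw [dist_comm] at h2
    nlinarith
  have h2 : ∑ y ∈ F, μ (Metric.ball y (ρ / 2)) ≤ V := by
    rw [← measure_biUnion_finset (s := F) (f := fun y => Metric.ball y (ρ / 2))]
    · refine measure_mono (Set.iUnion₂_subset fun y hy z hz => ?_)
      rw [Metric.mem_ball] at hz ⊢
      have := dist_triangle z y x
      have := hF y hy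
      nlinarith
    · intro y hy z hz hyz
      refine Metric.ball_disjoint_ball ?_
      have := hsep hy hz hyz
      linarith
    · exact fun y _ => Metric.isOpen_ball.measurableSet
  have h3 : (F.card : ENNReal) * V ≤ ENNReal.ofReal (A * (4 * l + 2) ^ n) * V := by
    calc (F.card : ENNReal) * V = ∑ y ∈ F, V := by rw [Finset.sum_const, nsmul_eq_mul]
      _ ≤ ∑ y ∈ F, ENNReal.ofReal (A * (4 * l + 2) ^ n) * μ (Metric.ball y (ρ / 2)) :=
        Finset.sum_le_sum h1
      _ = ENNReal.ofReal (A * (4 * l + 2) ^ n) * ∑ y ∈ F, μ (Metric.ball y (ρ / 2)) := by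
        rw [Finset.mul_sum]
      _ ≤ _ := mul_le_mul_right h2 _
  have h4 := (ENNReal.mul_le_mul_iff_left hV0 hVt).mp h3
  have h5 : (0 : ℝ) ≤ A * (4 * l + 2) ^ n := by positivity
  rw [← ENNReal.ofReal_natCast] at h4
  exact (ENNReal.ofReal_le_ofReal_iff h5).mp h4

/-- A maximal `ρ`-separated set. -/
theorem HomogeneousType.exists_net (hμ : HomogeneousType μ A n) (hA : 0 < A) {ρ : ℝ}
    (hρ : 0 < ρ) : ∃ N : Set X, N.Countable ∧ N.Pairwise (fun y z => ρ ≤ dist y z) ∧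
      ∀ x, ∃ y ∈ N, dist x y < ρ := by
  obtain ⟨N, hN⟩ := zorn_subset {S : Set X | S.Pairwise fun y z => ρ ≤ dist y z} (by
    intro c hc hch
    refine ⟨⋃₀ c, ?_, fun s hs => Set.subset_sUnion_of_mem hs⟩
    exact (Set.pairwise_sUnion hch.directedOn).mpr fun s hs => hc hs)
  have hsep : N.Pairwise fun y z => ρ ≤ dist y z := hN.prop
  refine ⟨N, ?_, hsep, fun x => ?_⟩
  · rcases N.eq_empty_or_nonempty with h0 | ⟨x, -⟩
    · rw [h0]; exact Set.countable_empty
    have hfin : ∀ k : ℕ, (N ∩ {y | dist y x ≤ k * ρ}).Finite := by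
      intro k
      by_contra hinf
      obtain ⟨q, hq⟩ := exists_nat_gt (A * (4 * (k : ℝ) + 2) ^ n)
      obtain ⟨F, hF, hcard⟩ := Set.Infinite.exists_subset_card_eq hinf q
      have := hμ.card_le hA hρ (Nat.cast_nonneg k) x F
        (hsep.mono fun y hy => (hF hy).1) fun y hy => (hF hy).2
      rw [hcard] at this
      linarith
    refine (Set.countable_iUnion fun k => (hfin k).countable).mono fun y hy => ?_
    obtain ⟨k, hk⟩ := exists_nat_ge (dist y x / ρ)
    exact Set.mem_iUnion.mpr ⟨k, hy, (div_le_iff₀ hρ).mp hk⟩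
  · by_contra! hx
    have hins : insert x N ∈ {S : Set X | S.Pairwise fun y z => ρ ≤ dist y z} := by
      refine hsep.insert fun y hy _ => ⟨hx y hy, ?_⟩
      rw [dist_comm]
      exact hx y hy
    have hxN : x ∈ N := hN.le_of_ge hins (Set.subset_insert x N) (Set.mem_insert x N)
    have := hx x hxN
    rw [dist_self] at this
    linarith

theorem summable_one_add_rpow_neg_two : Summable fun l : ℕ => (1 + (l : ℝ)) ^ (-2 : ℝ) := by
  have := (summable_nat_add_iff 1).mpr (Real.summable_nat_rpow (p := -2) |>.mpr (by norm_num))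
  refine this.congr fun l => ?_
  push_cast
  rw [add_comm]

/-- Sums over separated sets of a weight of decay exponent `n + 2` are bounded. -/
theorem HomogeneousType.sum_le (hμ : HomogeneousType μ A n) (hn : 0 < n) (hA : 0 < A) {ρ : ℝ}
    (hρ : 0 < ρ) (x : X) (F : Finset X) (hsep : (F : Set X).Pairwise fun y z => ρ ≤ dist y z) :
    ∑ y ∈ F, (1 + (⌊dist y x / ρ⌋₊ : ℝ)) ^ (-(n + 2)) ≤
      A * 6 ^ n * ∑' l : ℕ, (1 + (l : ℝ)) ^ (-2 : ℝ) := by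
  classical
  set I := F.image fun y => ⌊dist y x / ρ⌋₊ with hI
  rw [← Finset.sum_fiberwise_of_maps_to (t := I)
    (fun y hy => Finset.mem_image_of_mem (fun y => ⌊dist y x / ρ⌋₊) hy)]
  have h1 : ∀ l ∈ I, ∑ y ∈ F with ⌊dist y x / ρ⌋₊ = l, (1 + (⌊dist y x / ρ⌋₊ : ℝ)) ^ (-(n + 2))
      ≤ A * 6 ^ n * (1 + (l : ℝ)) ^ (-2 : ℝ) := by
    intro l _
    have h2 : ∑ y ∈ F with ⌊dist y x / ρ⌋₊ = l, (1 + (⌊dist y x / ρ⌋₊ : ℝ)) ^ (-(n + 2))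
        = (F.filter fun y => ⌊dist y x / ρ⌋₊ = l).card * (1 + (l : ℝ)) ^ (-(n + 2)) := by
      rw [← nsmul_eq_mul, ← Finset.sum_const]
      refine Finset.sum_congr rfl fun y hy => ?_
      rw [(Finset.mem_filter.mp hy).2]
    have h3 : ((F.filter fun y => ⌊dist y x / ρ⌋₊ = l).card : ℝ)
        ≤ A * (4 * ((l : ℝ) + 1) + 2) ^ n := by
      refine hμ.card_le hA hρ (by positivity) x _ (hsep.mono ?_) fun y hy => ?_
      · exact fun y hy => (Finset.mem_filter.mp hy).1
      · have := (Nat.lt_floor_add_one (dist y x / ρ)).le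
        rw [(Finset.mem_filter.mp hy).2] at this
        exact (div_le_iff₀ hρ).mp this
    have h4 : (4 * ((l : ℝ) + 1) + 2) ^ n ≤ 6 ^ n * (1 + (l : ℝ)) ^ n := by
      rw [← Real.mul_rpow (by norm_num) (by positivity)]
      exact Real.rpow_le_rpow (by positivity) (by linarith [Nat.cast_nonneg (α := ℝ) l]) hn.le
    have h5 : (1 + (l : ℝ)) ^ (-2 : ℝ) = (1 + (l : ℝ)) ^ n * (1 + (l : ℝ)) ^ (-(n + 2)) := by
      rw [← Real.rpow_add (by positivity)]
      congr 1; ring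
    rw [h2, h5]
    calc _ ≤ (A * (6 ^ n * (1 + (l : ℝ)) ^ n)) * (1 + (l : ℝ)) ^ (-(n + 2)) := by
          gcongr
          exact h3.trans (mul_le_mul_of_nonneg_left h4 hA.le)
      _ = _ := by ring
  refine (Finset.sum_le_sum h1).trans ?_
  rw [← Finset.mul_sum]
  refine mul_le_mul_of_nonneg_left ?_ (by positivity)
  exact summable_one_add_rpow_neg_two.sum_le_tsum I fun l _ => by positivity

end Nets

/-! ### Commutators of operators with Gaussian off-diagonal decay -/

/-- Gaussian factors of order `p ≥ 1` absorb all powers. -/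
theorem exists_gaussian_mul_pow_le {C c p : ℝ} (hC : 0 < C) (hc : 0 < c) (hp : 1 ≤ p) (N : ℕ)
    {α : ℝ} (hα : 0 < α) : ∃ G : ℝ, 0 < G ∧ ∀ d : ℝ, 0 ≤ d →
      (2 + d) ^ N * (C * Real.exp (-(c * d ^ p))) ≤ G * (1 + (⌊d⌋₊ : ℝ)) ^ (-α) := by
  obtain ⟨q, hq⟩ := exists_nat_ge α
  refine ⟨C * Real.exp (3 * c) * ((N + q).factorial / c ^ (N + q)), by positivity,
    fun d hd => ?_⟩
  have h1 : d ≤ 1 + d ^ p := by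
    rcases le_total d 1 with h | h
    · have := Real.rpow_nonneg hd p
      linarith
    · have := Real.rpow_le_rpow_of_exponent_le h hp
      rw [Real.rpow_one] at this
      linarith
  have h2 : Real.exp (-(c * d ^ p)) ≤ Real.exp (3 * c) * Real.exp (-(c * (2 + d))) := by
    rw [← Real.exp_add]
    apply Real.exp_le_exp.mpr
    nlinarith
  have h3 : (2 + d) ^ (N + q) * Real.exp (-(c * (2 + d))) ≤ (N + q).factorial / c ^ (N + q) := by
    have := Real.pow_div_factorial_le_exp (c * (2 + d)) (by positivity) (N + q)
    rw [div_le_iff₀ (by positivity), mul_pow] at this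
    rw [le_div_iff₀ (by positivity), Real.exp_neg, ← div_eq_mul_inv, div_mul_eq_mul_div,
      div_le_iff₀ (Real.exp_pos _)]
    linarith
  have h4 : (1 + (⌊d⌋₊ : ℝ)) ^ α ≤ (2 + d) ^ q := by
    calc (1 + (⌊d⌋₊ : ℝ)) ^ α ≤ (2 + d) ^ α :=
          Real.rpow_le_rpow (by positivity) (by linarith [Nat.floor_le hd]) hα.le
      _ ≤ (2 + d) ^ (q : ℝ) := Real.rpow_le_rpow_of_exponent_le (by linarith) hq
      _ = _ := Real.rpow_natCast _ _
  rw [Real.rpow_neg (by positivity), ← div_eq_mul_inv, le_div_iff₀ (by positivity)]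
  calc (2 + d) ^ N * (C * Real.exp (-(c * d ^ p))) * (1 + (⌊d⌋₊ : ℝ)) ^ α
      ≤ (2 + d) ^ N * (C * (Real.exp (3 * c) * Real.exp (-(c * (2 + d))))) * (2 + d) ^ q := by
        gcongr
    _ = C * Real.exp (3 * c) * ((2 + d) ^ (N + q) * Real.exp (-(c * (2 + d)))) := by
        rw [pow_add]; ring
    _ ≤ _ := mul_le_mul_of_nonneg_left h3 (by positivity)

/-- Off-diagonal Gaussian decay at scale `ρ` bounds the commutators with every function that is
Lipschitz at scale `ρ`, uniformly over spaces of homogeneous type. -/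
theorem exists_commBound_of_offDiagonal {A n C c p : ℝ} (hn : 0 < n) (hA : 0 < A) (hC : 0 < C)
    (hc : 0 < c) (hp : 1 ≤ p) (N : ℕ) : ∃ Q : ℝ, 0 < Q ∧
      ∀ (X : Type*) [MetricSpace X] [MeasurableSpace X] [BorelSpace X] (μ : Measure X),
        HomogeneousType μ A n → ∀ (T : Lp ℂ 2 μ →L[ℂ] Lp ℂ 2 μ) (ρ : ℝ), 0 < ρ →
        (∀ x y : X, ‖ballCutoff μ x ρ * T * ballCutoff μ y ρ‖ ≤
          C * Real.exp (-(c * (dist x y / ρ) ^ p))) →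
        ∀ (η : X → ℝ) (hη : MemLp (fun x => (η x : ℂ)) ⊤ μ),
          (∀ x y, |η x - η y| ≤ dist x y / ρ) → CommBound (mulOp μ hη) N T Q 1 := by
  obtain ⟨G, hG, hGb⟩ := exists_gaussian_mul_pow_le hC hc hp N (α := n + 2) (by linarith)
  set Z : ℝ := ∑' l : ℕ, (1 + (l : ℝ)) ^ (-2 : ℝ)
  have hZ : 0 ≤ Z := tsum_nonneg fun l => by positivity
  refine ⟨G * (A * 6 ^ n * Z) + 1, by positivity, ?_⟩
  intro X _ _ _ μ hμ T ρ hρ hT η hη hlip a ha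
  classical
  rw [one_pow, mul_one]
  obtain ⟨S, hScount, hSsep, hScov⟩ := hμ.exists_net hA hρ
  have : Countable S := hScount.to_subtype
  obtain ⟨enc, henc⟩ := exists_injective_nat S
  -- The partition assigns to a point the first ball of radius `ρ` of the net that contains it.
  set E : S → Set X := fun i =>
    Metric.ball (i : X) ρ \ ⋃ j : {j : S // enc j < enc i}, Metric.ball (j : X) ρ with hEdef
  have hEm : ∀ i, MeasurableSet (E i) := fun i => Metric.isOpen_ball.measurableSet.diff
    (MeasurableSet.iUnion fun j => Metric.isOpen_ball.measurableSet)
  have hEsub : ∀ i, E i ⊆ Metric.ball (i : X) ρ := fun i => Set.sdiff_subset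
  have hEd : ∀ i j, i ≠ j → Disjoint (E i) (E j) := by
    have hlt : ∀ i j, enc i < enc j → Disjoint (E i) (E j) := fun i j hij =>
      Set.disjoint_left.mpr fun x hxi hxj =>
        hxj.2 (Set.mem_iUnion.mpr ⟨⟨i, hij⟩, hEsub i hxi⟩)
    intro i j hij
    rcases lt_or_gt_of_ne (henc.ne hij) with h | h
    · exact hlt i j h
    · exact (hlt j i h).symm
  have hEc : ∀ x, ∃ i, x ∈ E i := by
    intro x
    have hex : ∃ k, ∃ i : S, enc i = k ∧ x ∈ Metric.ball (i : X) ρ := by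
      obtain ⟨y, hy, hxy⟩ := hScov x
      exact ⟨_, ⟨y, hy⟩, rfl, hxy⟩
    obtain ⟨i, hi, hxi⟩ := Nat.find_spec hex
    refine ⟨i, hxi, fun hx => ?_⟩
    obtain ⟨⟨j, hj⟩, hxj⟩ := Set.mem_iUnion.mp hx
    exact Nat.find_min hex (hi ▸ hj) ⟨j, rfl, hxj⟩
  set P : S → Lp ℂ 2 μ →L[ℂ] Lp ℂ 2 μ := fun i => cutoff μ (hEm i) with hPdef
  have hP : Resolution P := resolution_cutoff hEm hEd hEc
  set κ : S → S → ℝ := fun i j => G * (1 + (⌊dist (j : X) i / ρ⌋₊ : ℝ)) ^ (-(n + 2)) with hκ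
  have hrow : ∀ (i : S) (F : Finset S), ∑ j ∈ F, κ i j ≤ G * (A * 6 ^ n * Z) := by
    intro i F
    rw [← Finset.mul_sum]
    refine mul_le_mul_of_nonneg_left ?_ hG.le
    have := hμ.sum_le hn hA hρ (i : X) (F.map (Function.Embedding.subtype _)) ?_
    · rwa [Finset.sum_map] at this
    · refine hSsep.mono fun y hy => ?_
      obtain ⟨z, -, rfl⟩ := Finset.mem_map.mp hy
      exact z.2
  have hsymm : ∀ i j, κ i j = κ j i := fun i j => by rw [hκ]; simp only [dist_comm]
  refine (hP.norm_le_of_schur _ (by positivity) κ ?_ hrow ?_).trans (by linarith)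
  swap
  · intro j F
    simp only [hsymm _ j]
    exact hrow j F
  intro i j
  set d := dist (j : X) i / ρ with hd
  have hd0 : 0 ≤ d := by positivity
  have hu : ‖(mulOp μ hη - (η i : ℂ) • 1) * P i‖ ≤ 1 :=
    norm_mulOp_sub_mul_cutoff_le hη (hEm i) _ zero_le_one fun x hx => by
      rw [← Complex.ofReal_sub, Complex.norm_real, Real.norm_eq_abs]
      refine (hlip x i).trans ?_
      rw [div_le_one hρ]
      exact (Metric.mem_ball.mp (hEsub i hx)).le
  have hv : ‖P j * (mulOp μ hη - (η i : ℂ) • 1)‖ ≤ 1 + d := by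
    have hcomm : Commute (mulOp μ hη - (η i : ℂ) • 1) (P j) :=
      (commute_mulOp_cutoff hη (hEm j)).sub_left ((Commute.one_left _).smul_left _)
    rw [← hcomm.eq]
    refine norm_mulOp_sub_mul_cutoff_le hη (hEm j) _ (by positivity) fun x hx => ?_
    rw [← Complex.ofReal_sub, Complex.norm_real, Real.norm_eq_abs]
    refine (hlip x i).trans ?_
    have h1 := Metric.mem_ball.mp (hEsub j hx)
    have h2 := dist_triangle x j i
    rw [hd, div_le_iff₀ hρ, add_mul, div_mul_cancel₀ _ hρ.ne']
    linarith
  have hblock := norm_comm_pow_block_le (commute_mulOp_cutoff hη (hEm i))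
    (commute_mulOp_cutoff hη (hEm j)) (cutoff_mul_self (hEm i)) (cutoff_mul_self (hEm j))
    (η i : ℂ) hu hv T a
  have hTij : ‖P i * T * P j‖ ≤ C * Real.exp (-(c * d ^ p)) := by
    have h1 : P i * T * P j = P i * (ballCutoff μ i ρ * T * ballCutoff μ j ρ) * P j := by
      have e1 : P i * ballCutoff μ (i : X) ρ = P i :=
        cutoff_mul_cutoff_of_subset (hEm i) _ (hEsub i)
      have e2 : ballCutoff μ (j : X) ρ * P j = P j :=
        cutoff_mul_cutoff_of_subset' (hEm j) _ (hEsub j)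
      calc P i * T * P j = (P i * ballCutoff μ (i : X) ρ) * T * (ballCutoff μ (j : X) ρ * P j) := by
            rw [e1, e2]
        _ = _ := by simp only [mul_assoc]
    rw [h1, hd, dist_comm]
    refine ((norm_mul_le _ _).trans ?_).trans (hT i j)
    refine (mul_le_of_le_one_right (norm_nonneg _) (norm_cutoff_le _)).trans ?_
    exact (norm_mul_le _ _).trans (mul_le_of_le_one_left (norm_nonneg _) (norm_cutoff_le _))
  calc ‖P i * (comm (mulOp μ hη) ^ a) T * P j‖
      ≤ (1 + (1 + d)) ^ a * ‖P i * T * P j‖ := hblock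
    _ ≤ (2 + d) ^ N * (C * Real.exp (-(c * d ^ p))) := by
        have : 1 + (1 + d) = 2 + d := by ring
        rw [this]
        exact mul_le_mul (pow_le_pow_right₀ (by linarith) ha) hTij (norm_nonneg _) (by positivity)
    _ ≤ κ i j := hGb d hd0

/-! ### Exponentials in the continuous functional calculus -/

section Exponentials

variable {H : Type*} [NormedAddCommGroup H] [InnerProductSpace ℂ H] [CompleteSpace H]

theorem exp_cfc {a : H →L[ℂ] H} (ha : IsStarNormal a) {f : ℂ → ℂ}
    (hf : ContinuousOn f (spectrum ℂ a)) :
    NormedSpace.exp (cfc f a) = cfc (fun z => Complex.exp (f z)) a := by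
  rw [← CFC.complex_exp_eq_normedSpace_exp (cfc_predicate f a),
    ← cfc_comp' Complex.exp f a Complex.continuous_exp.continuousOn hf ha]

theorem norm_exp_cfc_le {a : H →L[ℂ] H} (ha : IsStarNormal a) {f : ℂ → ℂ}
    (hf : ContinuousOn f (spectrum ℂ a)) {θ : ℝ} (hθ : ∀ z ∈ spectrum ℂ a, (f z).re ≤ θ) :
    ‖NormedSpace.exp (cfc f a)‖ ≤ Real.exp θ := by
  rw [exp_cfc ha hf]
  refine norm_cfc_le (Real.exp_pos θ).le fun z hz => ?_
  rw [Complex.norm_exp]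
  exact Real.exp_le_exp.mpr (hθ z hz)

theorem exp_natCast_mul_smul (n : ℕ) (z : ℂ) (B : H →L[ℂ] H) :
    NormedSpace.exp ((n * z) • B) = NormedSpace.exp (z • B) ^ n := by
  let _ : NormedAlgebra ℚ (H →L[ℂ] H) := NormedAlgebra.restrictScalars ℚ ℂ (H →L[ℂ] H)
  rw [mul_smul, Nat.cast_smul_eq_nsmul, NormedSpace.exp_nsmul]

namespace NonnegSelfAdjoint

variable (L : NonnegSelfAdjoint H)

theorem isStarNormal_resolvent : IsStarNormal L.resolvent :=
  L.resolvent_nonneg.isSelfAdjoint.isStarNormal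

/-- The function of `(1 + L)⁻¹` that defines `F(L)`. -/
noncomputable def symbol (F : ℝ → ℂ) (z : ℂ) : ℂ := if z = 0 then 0 else F (z.re⁻¹ - 1)

theorem funcCalc_eq (F : ℝ → ℂ) : L.funcCalc F = cfc (symbol F) L.resolvent := rfl

theorem symbol_zero (F : ℝ → ℂ) : symbol F 0 = 0 := if_pos rfl

theorem symbol_of_ne (F : ℝ → ℂ) {z : ℂ} (hz : z ≠ 0) : symbol F z = F (z.re⁻¹ - 1) := if_neg hz

variable {L} in
theorem symbol_arg_nonneg {z : ℂ} (hz : z ∈ spectrum ℂ L.resolvent) (h0 : z ≠ 0) :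
    0 ≤ z.re⁻¹ - 1 := by
  obtain ⟨hz1, hz2, hz3⟩ := L.spectrum_resolvent hz
  have hpos : 0 < z.re := lt_of_le_of_ne hz2 fun h' => h0 (by rw [hz1, ← h']; simp)
  exact sub_nonneg.mpr ((one_le_inv₀ hpos).mpr hz3)

theorem continuousOn_symbol {F : ℝ → ℂ} (hF : Continuous F) (h0 : Tendsto F atTop (𝓝 0)) :
    ContinuousOn (symbol F) (spectrum ℂ L.resolvent) :=
  L.continuousOn_funcCalc hF h0

theorem tendsto_exp_symbol {w : ℂ} (hw : 0 < w.re) :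
    Tendsto (fun l : ℝ => Complex.exp (-(w * l))) atTop (𝓝 0) := by
  rw [tendsto_zero_iff_norm_tendsto_zero]
  have h : ∀ l : ℝ, ‖Complex.exp (-(w * l))‖ = Real.exp (-(w.re * l)) := fun l => by
    rw [Complex.norm_exp]; simp
  simp only [h]
  exact Real.tendsto_exp_neg_atTop_nhds_zero.comp (tendsto_id.const_mul_atTop hw)

theorem heat_eq (s : ℝ) : L.heat s = L.funcCalc fun l => Complex.exp (-((s : ℂ) * l)) := by
  rw [heat]
  congr 1
  funext l
  push_cast
  ring_nf

/-- A function with support in a compact interval, dilated, vanishes at infinity. -/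
theorem tendsto_comp_mul_of_tsupport {E : Type*} [NormedAddCommGroup E] {F : ℝ → E} {α β τ : ℝ}
    (hF : tsupport F ⊆ Set.Icc α β) (hτ : 0 < τ) :
    Tendsto (fun l => F (τ * l)) atTop (𝓝 0) := by
  refine tendsto_const_nhds.congr' ?_
  filter_upwards [eventually_gt_atTop (β / τ)] with l hl
  rw [div_lt_iff₀ hτ] at hl
  refine (image_eq_zero_of_notMem_tsupport fun h => ?_).symm
  have := (hF h).2
  linarith

end NonnegSelfAdjoint

end Exponentials

/-! ### Smooth functions of the semigroup -/

/-- In the variable `v = e^{-u}` a test function of `u` becomes a Schwartz function that lives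
inside `(0, 1)`. -/
theorem exists_schwartzMap_comp_exp {ζ : ℝ → ℂ} (hζ : ContDiff ℝ (⊤ : ℕ∞) ζ) {α β : ℝ}
    (hα : 0 < α) (hs : tsupport ζ ⊆ Set.Icc α β) :
    ∃ h : SchwartzMap ℝ ℂ, (∀ u, h (Real.exp (-u)) = ζ u) ∧ (∀ v, v ≤ 0 → h v = 0) ∧
      ∀ v, 1 ≤ v → h v = 0 := by
  have hz : ∀ u, u ∉ Set.Icc α β → ζ u = 0 := fun u hu =>
    image_eq_zero_of_notMem_tsupport fun h => hu (hs h)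
  set h : ℝ → ℂ := fun v => if 0 < v then ζ (-Real.log v) else 0 with hdef
  have hsmall : ∀ v, v < Real.exp (-β) → h v = 0 := by
    intro v hv
    by_cases hv0 : 0 < v
    · rw [hdef]
      simp only [if_pos hv0]
      refine hz _ fun hmem => ?_
      have := (Real.log_lt_iff_lt_exp hv0).mpr hv
      linarith [hmem.2]
    · simp [hdef, hv0]
  have hlarge : ∀ v, Real.exp (-α) < v → h v = 0 := by
    intro v hv
    have hv0 : 0 < v := (Real.exp_pos _).trans hv
    rw [hdef]
    simp only [if_pos hv0]
    refine hz _ fun hmem => ?_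
    have := (Real.lt_log_iff_exp_lt hv0).mpr hv
    linarith [hmem.1]
  have hcs : HasCompactSupport h := by
    refine HasCompactSupport.intro (isCompact_Icc (a := Real.exp (-β)) (b := Real.exp (-α)))
      fun v hv => ?_
    rcases lt_or_ge v (Real.exp (-β)) with h1 | h1
    · exact hsmall v h1
    · exact hlarge v (not_le.mp fun h2 => hv ⟨h1, h2⟩)
  have hsm : ContDiff ℝ (⊤ : ℕ∞) h := by
    rw [contDiff_iff_contDiffAt]
    intro v
    rcases lt_or_ge 0 v with hv | hv
    · have h1 : ContDiffAt ℝ (⊤ : ℕ∞) (fun v => ζ (-Real.log v)) v :=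
        hζ.contDiffAt.comp v (Real.contDiffAt_log.mpr hv.ne').neg
      refine h1.congr_of_eventuallyEq ?_
      filter_upwards [isOpen_Ioi.mem_nhds hv] with w hw
      exact if_pos hw
    · refine (contDiffAt_const (c := (0 : ℂ))).congr_of_eventuallyEq ?_
      filter_upwards [isOpen_Iio.mem_nhds (hv.trans_lt (Real.exp_pos (-β)))] with w hw
      exact hsmall w hw
  refine ⟨hcs.toSchwartzMap hsm, fun u => ?_, fun v hv => ?_, fun v hv => ?_⟩
  · change h (Real.exp (-u)) = ζ u
    simp [hdef, Real.exp_pos]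
  · change h v = 0
    exact if_neg (not_lt.mpr hv)
  · change h v = 0
    exact hlarge v ((Real.exp_lt_one_iff.mpr (by linarith)).trans_le hv)

theorem summable_schwartzMap_int (f : SchwartzMap ℝ ℂ) (N : ℕ) :
    Summable fun n : ℤ => ‖f n‖ * (1 + |(n : ℝ)|) ^ N := by
  obtain ⟨C, hC⟩ : ∃ C : ℝ, ∀ x : ℝ, (1 + |x|) ^ (N + 2) * ‖f x‖ ≤ C := by
    refine ⟨2 ^ (N + 2) * ((Finset.Iic (N + 2, 0)).sup fun m => SchwartzMap.seminorm ℝ m.1 m.2) f,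
      fun x => ?_⟩
    have := f.one_add_le_sup_seminorm_apply (𝕜 := ℝ) (m := (N + 2, 0)) le_rfl le_rfl x
    simpa using this
  have h2 : Summable fun n : ℤ => C * (1 + |(n : ℝ)|) ^ (-2 : ℝ) := by
    refine Summable.mul_left C ?_
    exact Summable.of_nat_of_neg (by simpa using summable_one_add_rpow_neg_two)
      (by simpa using summable_one_add_rpow_neg_two)
  refine Summable.of_nonneg_of_le (fun n => by positivity) (fun n => ?_) h2
  have h4 : (0 : ℝ) < 1 + |(n : ℝ)| := by positivity
  rw [Real.rpow_neg h4.le, ← div_eq_mul_inv, le_div_iff₀ (by positivity)]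
  refine le_trans (le_of_eq ?_) (hC n)
  rw [Real.rpow_two, pow_add]
  ring

/-- A bounded `b` can be absorbed into the constant `q`. -/
theorem CommBound.normalize {𝔸 : Type*} [NormedRing 𝔸] [NormedAlgebra ℂ 𝔸] {e X : 𝔸} {N : ℕ}
    {q b : ℝ} (h : CommBound e N X q b) (hb : 1 ≤ b) : CommBound e N X (q * b ^ N) 1 :=
  fun a ha => by
    rw [one_pow, mul_one]
    exact (h a ha).trans (mul_le_mul_of_nonneg_left (pow_le_pow_right₀ hb ha) h.nonneg)

/-- If the commutators of `e^{-τL}` with `e` are bounded, so are those of `ζ(τL)` for every test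
function `ζ` on `(0, ∞)`: by Poisson summation `ζ(τL)` is a rapidly convergent Fourier series
in `e^{-τL}`, and the commutators of the `n`-th term grow polynomially in `n`. -/
theorem exists_commBound_funcCalc {ζ : ℝ → ℂ} (hζ : ContDiff ℝ (⊤ : ℕ∞) ζ) {α β : ℝ}
    (hα : 0 < α) (hs : tsupport ζ ⊆ Set.Icc α β) (N : ℕ) (Q : ℝ) :
    ∃ Q' : ℝ, 0 < Q' ∧ ∀ (H : Type*) [NormedAddCommGroup H] [InnerProductSpace ℂ H]
      [CompleteSpace H] [Nontrivial H] (L : NonnegSelfAdjoint H) (τ : ℝ), 0 < τ →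
      ∀ e : H →L[ℂ] H, CommBound e N (L.heat τ) Q 1 →
        CommBound e N (L.funcCalc fun l => ζ (τ * l)) Q' 1 := by
  obtain ⟨h, hexp, hle, hge⟩ := exists_schwartzMap_comp_exp hζ hα hs
  set c : ℤ → ℂ := fun n => FourierTransform.fourier h (n : ℝ) with hc
  set b : ℝ := 1 + Real.exp (2 * Real.pi * Q * Real.exp 1) * N.factorial with hb
  have hb1 : 1 ≤ b := by
    have : 0 ≤ Real.exp (2 * Real.pi * Q * Real.exp 1) * N.factorial := by positivity
    rw [hb]
    linarith
  have hsum := summable_schwartzMap_int (FourierTransform.fourier h) N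
  have hsum0 : Summable fun n => ‖c n‖ := by
    simpa using summable_schwartzMap_int (FourierTransform.fourier h) 0
  set S : ℝ := ∑' n : ℤ, ‖c n‖ * (1 + |(n : ℝ)|) ^ N with hS
  have hS0 : 0 ≤ S := tsum_nonneg fun n => by positivity
  refine ⟨S * b ^ N + 1, by positivity, ?_⟩
  intro H _ _ _ _ L τ hτ e he
  have ha := L.isStarNormal_resolvent
  set g : ℂ → ℂ := NonnegSelfAdjoint.symbol fun l => (Real.exp (-(τ * l)) : ℂ) with hg
  have hA : L.heat τ = cfc g L.resolvent := rfl
  have hgc : ContinuousOn g (spectrum ℂ L.resolvent) := by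
    refine L.continuousOn_symbol (by fun_prop) ?_
    have := NonnegSelfAdjoint.tendsto_exp_symbol (w := τ) (by simpa using hτ)
    refine this.congr fun l => ?_
    push_cast
    ring_nf
  -- On the spectrum `g` takes values in `[0, 1]`, and the test function is `h ∘ g`.
  have hgx : ∀ z ∈ spectrum ℂ L.resolvent, ∃ x : ℝ, g z = x ∧ 0 ≤ x ∧ x ≤ 1 ∧
      NonnegSelfAdjoint.symbol (fun l => ζ (τ * l)) z = h x := by
    intro z hz
    by_cases h0 : z = 0
    · refine ⟨0, ?_, le_rfl, zero_le_one, ?_⟩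
      · rw [h0, hg, NonnegSelfAdjoint.symbol_zero]; simp
      · rw [h0, NonnegSelfAdjoint.symbol_zero, hle 0 le_rfl]
    · have hnn := NonnegSelfAdjoint.symbol_arg_nonneg hz h0
      refine ⟨Real.exp (-(τ * (z.re⁻¹ - 1))), ?_, (Real.exp_pos _).le, ?_, ?_⟩
      · rw [hg, NonnegSelfAdjoint.symbol_of_ne _ h0]
      · rw [Real.exp_le_one_iff]
        nlinarith [mul_nonneg hτ.le hnn]
      · rw [NonnegSelfAdjoint.symbol_of_ne _ h0, hexp]
  set V : ℤ → H →L[ℂ] H := fun n => NormedSpace.exp ((2 * Real.pi * Complex.I * n) • L.heat τ)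
    with hV
  have hgmul : ∀ z : ℂ, ContinuousOn (fun w => z * g w) (spectrum ℂ L.resolvent) := fun z =>
    continuousOn_const.mul hgc
  have hexpc : ∀ z : ℂ, ContinuousOn (fun w => Complex.exp (z * g w))
      (spectrum ℂ L.resolvent) := fun z => Complex.continuous_exp.comp_continuousOn (hgmul z)
  have hsmul : ∀ z : ℂ, z • L.heat τ = cfc (fun w => z * g w) L.resolvent := fun z => by
    rw [hA, cfc_const_mul z g L.resolvent hgc]
  have hVcfc : ∀ n, V n = cfc (fun w => Complex.exp (2 * Real.pi * Complex.I * n * g w))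
      L.resolvent := fun n => by
    rw [hV]
    simp only
    rw [hsmul, exp_cfc ha (hgmul _)]
  have hVb : ∀ n, CommBound e N (V n) 1 (b * |(n : ℝ)|) := by
    have hunit : ∀ z : ℂ, z.re = 0 → ‖z‖ = 2 * Real.pi →
        CommBound e N (NormedSpace.exp (z • L.heat τ)) 1 b := by
      intro z hz0 hz
      have h1 := (he.smul z).exp zero_le_one
      rw [hz] at h1
      have h2 : ‖NormedSpace.exp (z • L.heat τ)‖ ≤ 1 := by
        rw [hsmul, ← Real.exp_zero]
        refine norm_exp_cfc_le ha (hgmul _) fun w hw => ?_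
        obtain ⟨x, hx, -⟩ := hgx w hw
        rw [hx]
        simp [hz0]
      have := h1.of_norm_le zero_le_one one_pos h2
      rwa [mul_one, div_one] at this
    have hpi : ‖(2 * Real.pi * Complex.I : ℂ)‖ = 2 * Real.pi := by
      simp [abs_of_pos Real.pi_pos]
    intro n
    obtain ⟨k, rfl | rfl⟩ := n.eq_nat_or_neg
    · have h1 := (hunit (2 * Real.pi * Complex.I) (by simp) hpi).pow k
      rw [← exp_natCast_mul_smul, one_pow] at h1
      convert! h1 using 1
      · rw [hV]; simp only; congr 2; push_cast; ring
      · simp [mul_comm]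
    · have h1 := (hunit (-(2 * Real.pi * Complex.I)) (by simp) (by rw [norm_neg, hpi])).pow k
      rw [← exp_natCast_mul_smul, one_pow] at h1
      convert! h1 using 1
      · rw [hV]; simp only; congr 2; push_cast; ring
      · simp [mul_comm]
  have hHas : HasSum (fun n => c n • V n) (L.funcCalc fun l => ζ (τ * l)) := by
    have hu := tendstoUniformlyOn_tsum hsum0 (s := spectrum ℂ L.resolvent)
      (f := fun n w => c n * Complex.exp (2 * Real.pi * Complex.I * n * g w)) (by
        intro n w hw
        obtain ⟨x, hx, -⟩ := hgx w hw
        rw [norm_mul, hx, Complex.norm_exp]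
        simp)
    have hcont : ∀ n : ℤ, ContinuousOn
        (fun w => c n * Complex.exp (2 * Real.pi * Complex.I * n * g w))
        (spectrum ℂ L.resolvent) := fun n =>
      continuousOn_const.mul (hexpc _)
    have ht := tendsto_cfc_fun (a := L.resolvent) hu
      (Eventually.of_forall fun s => continuousOn_finsetSum s fun n _ => hcont n)
    have hlim : cfc (fun w => ∑' n : ℤ, c n * Complex.exp (2 * Real.pi * Complex.I * n * g w))
        L.resolvent = L.funcCalc fun l => ζ (τ * l) := by
      rw [NonnegSelfAdjoint.funcCalc_eq]
      refine cfc_congr fun w hw => ?_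
      obtain ⟨x, hx, hx0, hx1, hxh⟩ := hgx w hw
      rw [hxh, hx]
      have hP := h.tsum_eq_tsum_fourier x
      have hsingle : ∑' n : ℤ, h (x + n) = h x := by
        rw [tsum_eq_single 0]
        · simp
        · intro n hn
          rcases lt_or_gt_of_ne hn with hn | hn
          · have : (n : ℝ) ≤ -1 := by exact_mod_cast Int.le_sub_one_of_lt hn
            exact hle _ (by linarith)
          · have : (1 : ℝ) ≤ n := by exact_mod_cast hn
            exact hge _ (by linarith)
      rw [← hsingle, hP]
      refine tsum_congr fun n => ?_
      rw [fourier_coe_apply]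
      simp [hc]
    rw [hlim] at ht
    refine ht.congr fun s => ?_
    have hsumcfc := cfc_sum (fun (n : ℤ) w => c n * Complex.exp (2 * Real.pi * Complex.I * n * g w))
      L.resolvent s fun n _ => hcont n
    rw [Finset.sum_fn] at hsumcfc
    rw [hsumcfc]
    refine Finset.sum_congr rfl fun n _ => ?_
    change _ = c n • V n
    rw [hVcfc, cfc_const_mul (c n) _ L.resolvent (hexpc _)]
  have hfin := (CommBound.of_hasSum hVb (by linarith) (fun n => abs_nonneg _) hsum hHas).normalize
    hb1
  exact hfin.mono zero_le_one (by linarith) le_rfl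

/-! ### Replacing `L` by a bounded operator -/

/-- A smooth truncation of `u ↦ u - 1/8`: it agrees with that function on `[1/4, 4]`. -/
theorem exists_truncation : ∃ ζ : ℝ → ℝ, ContDiff ℝ (⊤ : ℕ∞) ζ ∧
    tsupport ζ ⊆ Set.Icc (1 / 8) (33 / 8) ∧ (∀ u, 0 ≤ ζ u) ∧
      ∀ u ∈ Set.Icc (1 / 4 : ℝ) 4, ζ u = u - 1 / 8 := by
  let χ : ContDiffBump (17 / 8 : ℝ) := ⟨15 / 8, 2, by norm_num, by norm_num⟩
  have hsupp : tsupport χ = Set.Icc (1 / 8) (33 / 8) := by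
    rw [χ.tsupport_eq, Real.closedBall_eq_Icc]
    norm_num [χ]
  have h1 : tsupport (fun u => χ u * (u - 1 / 8)) ⊆ Set.Icc (1 / 8) (33 / 8) :=
    hsupp ▸ tsupport_mul_subset_left
  refine ⟨fun u => χ u * (u - 1 / 8), ?_, h1, fun u => ?_, fun u hu => ?_⟩
  · exact χ.contDiff.mul (contDiff_id.sub contDiff_const)
  · by_cases h : u ∈ Set.Icc (1 / 8 : ℝ) (33 / 8)
    · exact mul_nonneg χ.nonneg (sub_nonneg.mpr h.1)
    · exact (image_eq_zero_of_notMem_tsupport fun h' => h (h1 h')).ge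
  · have : χ u = 1 := by
      refine χ.one_of_mem_closedBall ?_
      rw [Real.closedBall_eq_Icc]
      constructor
      · norm_num [χ]; linarith [hu.1]
      · norm_num [χ]; linarith [hu.2]
    change χ u * (u - 1 / 8) = _
    rw [this, one_mul]

section Truncation

variable {H : Type*} [NormedAddCommGroup H] [InnerProductSpace ℂ H] [CompleteSpace H]

namespace NonnegSelfAdjoint

variable (L : NonnegSelfAdjoint H)

/-- The bounded operator `ψ(τL)` with `ψ = 1/8 + ζ`. -/
noncomputable def truncated (ζ : ℝ → ℝ) (τ : ℝ) : H →L[ℂ] H :=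
  (1 / 8 : ℂ) • 1 + L.funcCalc fun l => (ζ (τ * l) : ℂ)

variable {ζ : ℝ → ℝ} {τ : ℝ}

theorem continuousOn_symbol_truncation (hζ : Continuous ζ) {α β : ℝ}
    (hs : tsupport ζ ⊆ Set.Icc α β) (hτ : 0 < τ) :
    ContinuousOn (symbol fun l => (ζ (τ * l) : ℂ)) (spectrum ℂ L.resolvent) := by
  refine L.continuousOn_symbol (by fun_prop) ?_
  have := (Complex.continuous_ofReal.tendsto 0).comp (tendsto_comp_mul_of_tsupport hs hτ)
  rwa [Complex.ofReal_zero] at this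

theorem smul_truncated (hζ : Continuous ζ) {α β : ℝ} (hs : tsupport ζ ⊆ Set.Icc α β)
    (hτ : 0 < τ) (z : ℂ) : z • L.truncated ζ τ =
      cfc (fun w => z * (1 / 8 + symbol (fun l => (ζ (τ * l) : ℂ)) w)) L.resolvent := by
  have ha := L.isStarNormal_resolvent
  have hc := L.continuousOn_symbol_truncation hζ hs hτ
  have hc' : ContinuousOn (fun w => 1 / 8 + symbol (fun l => (ζ (τ * l) : ℂ)) w)
      (spectrum ℂ L.resolvent) := continuousOn_const.add hc
  rw [truncated, funcCalc_eq, cfc_const_mul z _ L.resolvent hc',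
    cfc_const_add (1 / 8 : ℂ) _ L.resolvent hc, Algebra.algebraMap_eq_smul_one]

theorem norm_exp_truncated_le (hζ : Continuous ζ) {α β : ℝ} (hs : tsupport ζ ⊆ Set.Icc α β)
    (hτ : 0 < τ) (h0 : ∀ u, 0 ≤ ζ u) {z : ℂ} (hz : z.re ≤ 0) :
    ‖NormedSpace.exp (z • L.truncated ζ τ)‖ ≤ Real.exp (z.re / 8) := by
  have ha := L.isStarNormal_resolvent
  rw [L.smul_truncated hζ hs hτ]
  have hc : ContinuousOn (fun w => z * (1 / 8 + symbol (fun l => (ζ (τ * l) : ℂ)) w))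
      (spectrum ℂ L.resolvent) := continuousOn_const.mul (continuousOn_const.add
    (L.continuousOn_symbol_truncation hζ hs hτ))
  refine norm_exp_cfc_le ha hc fun w _ => ?_
  have hx : ∃ x : ℝ, 0 ≤ x ∧ symbol (fun l => (ζ (τ * l) : ℂ)) w = x := by
    by_cases hw : w = 0
    · exact ⟨0, le_rfl, by rw [hw, symbol_zero]; simp⟩
    · exact ⟨_, h0 _, symbol_of_ne _ hw⟩
  obtain ⟨x, hx0, hx⟩ := hx
  have h18 : (1 / 8 + (x : ℂ)) = ((1 / 8 + x : ℝ) : ℂ) := by push_cast; ring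
  rw [hx, h18, Complex.re_mul_ofReal]
  nlinarith

/-- On the range of `φ(τL)` the operator `L` is bounded, and the semigroup generated by `L` is the
one generated by the truncation of `L`. -/
theorem semiconjBy_exp_truncated (hζ : Continuous ζ) {α β : ℝ}
    (hs : tsupport ζ ⊆ Set.Icc α β) (hζu : ∀ u ∈ Set.Icc (1 / 4 : ℝ) 4, ζ u = u - 1 / 8)
    (hτ : 0 < τ) {φ : ℝ → ℂ} (hφ : Continuous φ) (hφs : tsupport φ ⊆ Set.Icc (1 / 4) 4)
    {w : ℂ} (hw : 0 < w.re) :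
    SemiconjBy (L.funcCalc fun l => φ (τ * l))
      (NormedSpace.exp ((-(w / τ)) • L.truncated ζ τ))
      (L.funcCalc fun l => Complex.exp (-(w * l))) := by
  have ha := L.isStarNormal_resolvent
  have hc := L.continuousOn_symbol_truncation hζ hs hτ
  have hcφ : ContinuousOn (symbol fun l => φ (τ * l)) (spectrum ℂ L.resolvent) :=
    L.continuousOn_symbol (by fun_prop) (tendsto_comp_mul_of_tsupport hφs hτ)
  have hcw : ContinuousOn (symbol fun l => Complex.exp (-(w * l))) (spectrum ℂ L.resolvent) :=
    L.continuousOn_symbol (by fun_prop) (tendsto_exp_symbol hw)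
  have hcb : ContinuousOn
      (fun z => -(w / τ) * (1 / 8 + symbol (fun l => (ζ (τ * l) : ℂ)) z))
      (spectrum ℂ L.resolvent) := continuousOn_const.mul (continuousOn_const.add hc)
  have hce : ContinuousOn (fun z => Complex.exp
      (-(w / τ) * (1 / 8 + symbol (fun l => (ζ (τ * l) : ℂ)) z))) (spectrum ℂ L.resolvent) :=
    Complex.continuous_exp.comp_continuousOn hcb
  rw [SemiconjBy, L.smul_truncated hζ hs hτ, exp_cfc ha hcb, funcCalc_eq, funcCalc_eq,
    ← cfc_mul _ _ L.resolvent hcφ hce,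
    ← cfc_mul _ _ L.resolvent hcw hcφ]
  congr 1
  funext z
  by_cases hz : z = 0
  · rw [hz, symbol_zero, symbol_zero]; simp
  rw [symbol_of_ne _ hz, symbol_of_ne _ hz, symbol_of_ne _ hz]
  set l := z.re⁻¹ - 1
  by_cases hl : τ * l ∈ Set.Icc (1 / 4 : ℝ) 4
  · rw [hζu _ hl, mul_comm]
    congr 2
    have hτ' : (τ : ℂ) ≠ 0 := by exact_mod_cast hτ.ne'
    push_cast
    field_simp
    ring
  · rw [image_eq_zero_of_notMem_tsupport fun h => hl (hφs h), zero_mul, mul_zero]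

theorem semiconjBy_schrodinger (hζ : Continuous ζ) {α β : ℝ}
    (hs : tsupport ζ ⊆ Set.Icc α β) (hζu : ∀ u ∈ Set.Icc (1 / 4 : ℝ) 4, ζ u = u - 1 / 8)
    (hτ : 0 < τ) {φ : ℝ → ℂ} (hφ : Continuous φ) (hφs : tsupport φ ⊆ Set.Icc (1 / 4) 4)
    (t : ℝ) :
    SemiconjBy (L.funcCalc fun l => φ (τ * l))
      (NormedSpace.exp ((Complex.I * (t / τ)) • L.truncated ζ τ)) (L.schrodinger t) := by
  set Φ := L.funcCalc fun l => φ (τ * l)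
  set B := L.truncated ζ τ
  let _ : NormedAlgebra ℚ (H →L[ℂ] H) := NormedAlgebra.restrictScalars ℚ ℂ (H →L[ℂ] H)
  have h1 : ∀ ε : ℝ, 0 < ε → Φ * NormedSpace.exp ((-((ε - Complex.I * t) / τ)) • B)
      = L.complexHeat t ε * Φ := fun ε hε =>
    L.semiconjBy_exp_truncated hζ hs hζu hτ hφ hφs (w := ε - Complex.I * t) (by simpa using hε)
  have h2 : Tendsto (fun ε : ℝ => Φ * NormedSpace.exp ((-((ε - Complex.I * t) / τ)) • B))
      (𝓝[>] 0) (𝓝 (Φ * NormedSpace.exp ((Complex.I * (t / τ)) • B))) := by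
    have hcont : Continuous fun ε : ℝ =>
        Φ * NormedSpace.exp ((-((ε - Complex.I * t) / τ)) • B) := by
      have h' : Continuous fun ε : ℝ => -((ε - Complex.I * t) / τ : ℂ) := by fun_prop
      have h : Continuous fun ε : ℝ => (-((ε - Complex.I * t) / τ)) • B :=
        h'.smul continuous_const
      exact continuous_const.mul (NormedSpace.exp_continuous.comp h)
    have := (hcont.tendsto 0).mono_left (nhdsWithin_le_nhds (s := Set.Ioi 0))
    convert! this using 5
    push_cast
    ring
  rw [SemiconjBy]
  ext1 f
  have h3 := ((ContinuousLinearMap.apply ℂ H f).continuous.tendsto _).comp h2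
  have h4 : Tendsto (fun ε => L.complexHeat t ε (Φ f)) (𝓝[>] 0) (𝓝 (L.schrodinger t (Φ f))) :=
    L.tendsto_schrodinger t (Φ f)
  refine tendsto_nhds_unique h3 (h4.congr' ?_)
  filter_upwards [self_mem_nhdsWithin] with ε hε
  change _ = (Φ * NormedSpace.exp ((-((ε - Complex.I * t) / τ)) • B)) f
  rw [h1 ε hε, mul_apply_eq_comp]

end NonnegSelfAdjoint

end Truncation

/-! ### Commutators of the localized Schrödinger group -/

/-- The semigroup generated by a truncation of `L` that is bounded below by `1/8`: exponential
decay in time beats the polynomial growth of the commutators. -/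
theorem exists_commBound_exp_neg_truncated (N : ℕ) (q : ℝ) (hq : 0 < q) :
    ∃ Q : ℝ, 0 < Q ∧ ∀ (H : Type*) [NormedAddCommGroup H] [InnerProductSpace ℂ H]
      [CompleteSpace H] [Nontrivial H] (e B : H →L[ℂ] H), CommBound e N B q 1 →
      (∀ z : ℂ, z.re ≤ 0 → ‖NormedSpace.exp (z • B)‖ ≤ Real.exp (z.re / 8)) →
      ∀ σ : ℝ, 0 < σ → CommBound e N (NormedSpace.exp ((-(σ : ℂ)) • B)) Q 1 := by
  set E : ℝ := Real.exp (q * Real.exp 1) * N.factorial with hE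
  have hE0 : 0 < E := by positivity
  set b : ℝ := 1 + E * Real.exp (1 / 8) with hb
  have hb1 : 1 ≤ b := by rw [hb]; linarith [show 0 ≤ E * Real.exp (1 / 8) from by positivity]
  refine ⟨Real.exp (1 / 8) * (8 ^ N * N.factorial) * b ^ N, by positivity, ?_⟩
  intro H _ _ _ _ e B hB hnorm σ hσ
  set k := ⌈σ⌉₊ with hk
  have hk0 : 0 < k := Nat.ceil_pos.mpr hσ
  have hkr : (0 : ℝ) < k := by exact_mod_cast hk0
  set z : ℝ := σ / k with hz
  have hz0 : 0 < z := by positivity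
  have hz1 : z ≤ 1 := (div_le_one hkr).mpr (Nat.le_ceil σ)
  have h1 : CommBound e N ((-(z : ℂ)) • B) q 1 := by
    refine (hB.smul (-(z : ℂ))).mono zero_le_one ?_ le_rfl
    rw [norm_neg, Complex.norm_real, Real.norm_of_nonneg hz0.le]
    nlinarith
  have h2 := (h1.exp zero_le_one).of_norm_le zero_le_one (Real.exp_pos (-z / 8))
    (by simpa using hnorm (-(z : ℂ)) (by simpa using hz0.le))
  have h3 := (h2.mono (b' := b) (by positivity) le_rfl (by
    rw [mul_one, hb, div_eq_mul_inv, ← Real.exp_neg]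
    gcongr
    linarith)).pow k
  rw [← exp_natCast_mul_smul, ← Real.exp_nat_mul] at h3
  have e1 : (k : ℂ) * -(z : ℂ) = -(σ : ℂ) := by
    have : (k : ℝ) * z = σ := by rw [hz]; field_simp
    rw [← this]; push_cast; ring
  have e2 : (k : ℝ) * (-z / 8) = -(σ / 8) := by rw [hz]; field_simp
  rw [e1, e2] at h3
  intro a ha
  refine (h3 a ha).trans ?_
  rw [one_pow, mul_one, mul_pow]
  have h4 : (k : ℝ) ^ a ≤ (1 + σ) ^ N := by
    calc (k : ℝ) ^ a ≤ (1 + σ) ^ a :=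
          pow_le_pow_left₀ hkr.le (by linarith [Nat.ceil_lt_add_one hσ.le]) a
      _ ≤ _ := pow_le_pow_right₀ (by linarith) ha
  have h5 : Real.exp (-(σ / 8)) * (1 + σ) ^ N ≤ Real.exp (1 / 8) * (8 ^ N * N.factorial) := by
    have := Real.pow_div_factorial_le_exp ((1 + σ) / 8) (by positivity) N
    rw [div_le_iff₀ (by positivity), div_pow, div_le_iff₀ (by positivity)] at this
    have h6 : Real.exp (-(σ / 8)) * Real.exp ((1 + σ) / 8) = Real.exp (1 / 8) := by
      rw [← Real.exp_add]; congr 1; ring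
    calc Real.exp (-(σ / 8)) * (1 + σ) ^ N
        ≤ Real.exp (-(σ / 8)) * (Real.exp ((1 + σ) / 8) * N.factorial * 8 ^ N) := by gcongr
      _ = (Real.exp (-(σ / 8)) * Real.exp ((1 + σ) / 8)) * (8 ^ N * N.factorial) := by ring
      _ = _ := by rw [h6]
  calc Real.exp (-(σ / 8)) * ((k : ℝ) ^ a * b ^ a)
      ≤ Real.exp (-(σ / 8)) * ((1 + σ) ^ N * b ^ N) := by gcongr
    _ = Real.exp (-(σ / 8)) * (1 + σ) ^ N * b ^ N := by ring
    _ ≤ _ := by gcongr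

/-- The unitary group generated by a truncation of `L`, at integer times `R`: the commutators of
order `a` grow like `R ^ a`, which expresses finite speed of propagation. -/
theorem commBound_exp_I_mul {H : Type*} [NormedAddCommGroup H] [InnerProductSpace ℂ H]
    [CompleteSpace H] [Nontrivial H] {e B : H →L[ℂ] H} {N : ℕ} {q : ℝ}
    (hB : CommBound e N B q 1)
    (hnorm : ∀ z : ℂ, z.re ≤ 0 → ‖NormedSpace.exp (z • B)‖ ≤ Real.exp (z.re / 8)) (R : ℕ) :
    CommBound e N (NormedSpace.exp ((R * Complex.I) • B)) 1
      (R * (1 + Real.exp (q * Real.exp 1) * N.factorial)) := by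
  have h1 := ((hB.smul Complex.I).exp zero_le_one).of_norm_le zero_le_one one_pos
    (by simpa using hnorm Complex.I (by simp))
  rw [Complex.norm_I, one_mul, mul_one, div_one] at h1
  have h2 := h1.pow R
  rwa [← exp_natCast_mul_smul, one_pow] at h2

/-- Commutators of `(1 - e^{-sL})^K e^{itL} φ(τL)` with an operator for which those of `e^{-τL}`
are bounded; here `R = t / τ` is an integer. -/
theorem exists_commBound_localized {φ : ℝ → ℂ} (hφ : ContDiff ℝ (⊤ : ℕ∞) φ)
    (hφs : tsupport φ ⊆ Set.Icc (1 / 4) 4) (K N : ℕ) (Q : ℝ) :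
    ∃ Q' b : ℝ, 0 < Q' ∧ 1 ≤ b ∧ ∀ (H : Type*) [NormedAddCommGroup H] [InnerProductSpace ℂ H]
      [CompleteSpace H] [Nontrivial H] (L : NonnegSelfAdjoint H) (τ : ℝ), 0 < τ →
      ∀ e : H →L[ℂ] H, CommBound e N (L.heat τ) Q 1 → ∀ (s t : ℝ) (R : ℕ), 0 < s → 1 ≤ R →
        t / τ = R →
        CommBound e N ((1 - L.heat s) ^ K * L.schrodinger t * L.funcCalc fun l => φ (τ * l))
          Q' (R * b) := by
  obtain ⟨ζ, hζ, hζs, hζ0, hζu⟩ := exists_truncation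
  have hζs' : tsupport (fun u => (ζ u : ℂ)) ⊆ Set.Icc (1 / 8) (33 / 8) := by
    refine subset_trans (closure_mono fun u hu => ?_) hζs
    rw [Function.mem_support] at hu ⊢
    exact fun h => hu (by simp [h])
  obtain ⟨q₁, hq₁, h₁⟩ := exists_commBound_funcCalc hφ (by norm_num) hφs N Q
  obtain ⟨q₂, hq₂, h₂⟩ := exists_commBound_funcCalc (ζ := fun u => (ζ u : ℂ))
    (Complex.ofRealCLM.contDiff.comp hζ) (by norm_num) hζs' N Q
  set q := 1 / 8 + q₂ with hq
  have hq0 : 0 < q := by positivity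
  obtain ⟨q₃, hq₃, h₃⟩ := exists_commBound_exp_neg_truncated N q hq0
  set b := 1 + Real.exp (q * Real.exp 1) * N.factorial with hb
  have hb1 : 0 ≤ b := by positivity
  refine ⟨q₁ * ((1 + q₃) ^ K * 1), 1 + K + b, by positivity, by
    linarith [Nat.cast_nonneg (α := ℝ) K], ?_⟩
  intro H _ _ _ _ L τ hτ e he s t R hs hR htR
  set B := L.truncated ζ τ with hBdef
  set Φ := L.funcCalc fun l => φ (τ * l) with hΦ
  have hB : CommBound e N B q 1 := by
    have h8 : CommBound e N ((1 / 8 : ℂ) • (1 : H →L[ℂ] H)) (1 / 8) 1 :=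
      ((CommBound.one e N).smul (1 / 8)).mono le_rfl (by simp) zero_le_one
    exact h8.add (h₂ H L τ hτ e he)
  have hnorm : ∀ z : ℂ, z.re ≤ 0 → ‖NormedSpace.exp (z • B)‖ ≤ Real.exp (z.re / 8) :=
    fun z hz => L.norm_exp_truncated_le hζ.continuous hζs hτ hζ0 hz
  have hheat : SemiconjBy Φ (NormedSpace.exp ((-((s / τ : ℝ) : ℂ)) • B)) (L.heat s) := by
    rw [L.heat_eq]
    have := L.semiconjBy_exp_truncated hζ.continuous hζs hζu hτ hφ.continuous hφs
      (w := s) (by simpa using hs)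
    push_cast
    exact this
  have hschr : SemiconjBy Φ (NormedSpace.exp ((R * Complex.I) • B)) (L.schrodinger t) := by
    have := L.semiconjBy_schrodinger hζ.continuous hζs hζu hτ hφ.continuous hφs t
    have e1 : Complex.I * ((t : ℂ) / τ) = R * Complex.I := by
      rw [← Complex.ofReal_div, htR, mul_comm]; simp
    rwa [e1] at this
  have hsemi := (((SemiconjBy.one_right Φ).sub_right hheat).pow_right K).mul_right hschr
  rw [← hsemi.eq]
  have hone : CommBound e N (1 - NormedSpace.exp ((-((s / τ : ℝ) : ℂ)) • B)) (1 + q₃) 1 := by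
    have h4 := (h₃ H e B hB hnorm (s / τ) (by positivity)).smul (-1)
    have h5 := ((CommBound.one e N).mono le_rfl le_rfl zero_le_one).add h4
    simpa [sub_eq_add_neg] using h5
  have hfin := (h₁ H L τ hτ e he).mul ((hone.pow K).mul (commBound_exp_I_mul hB hnorm R))
  refine hfin.mono (by positivity) le_rfl ?_
  have hR' : (1 : ℝ) ≤ R := by exact_mod_cast hR
  have hK : (0 : ℝ) ≤ K := Nat.cast_nonneg K
  rw [← hb]
  nlinarith

/-! ### Off-diagonal decay -/

section OffDiagonal

variable {X : Type*} [MetricSpace X]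

/-- The distance to `E`, truncated at `D` and measured in units of `ρ`. -/
noncomputable def distFun (E : Set X) (D ρ : ℝ) (x : X) : ℝ := min (Metric.infDist x E) D / ρ

theorem abs_distFun_sub_le (E : Set X) (D : ℝ) {ρ : ℝ} (hρ : 0 < ρ) (x y : X) :
    |distFun E D ρ x - distFun E D ρ y| ≤ dist x y / ρ := by
  rw [distFun, distFun, ← sub_div, abs_div, abs_of_pos hρ]
  refine div_le_div_of_nonneg_right ?_ hρ.le
  refine (abs_min_sub_min_le_max _ _ _ _).trans ?_
  rw [sub_self, abs_zero, max_eq_left (abs_nonneg _), abs_sub_le_iff]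
  constructor
  · linarith [Metric.infDist_le_infDist_add_dist (s := E) (x := x) (y := y)]
  · linarith [Metric.infDist_le_infDist_add_dist (s := E) (x := y) (y := x), dist_comm x y]

variable [MeasurableSpace X] [BorelSpace X] {μ : Measure X}

theorem memLp_distFun (E : Set X) {D ρ : ℝ} (hD : 0 ≤ D) (hρ : 0 < ρ) :
    MemLp (fun x => (distFun E D ρ x : ℂ)) ⊤ μ := by
  have hc : Continuous fun x => (distFun E D ρ x : ℂ) := by
    refine Complex.continuous_ofReal.comp ?_
    exact ((Metric.continuous_infDist_pt E).min continuous_const).div_const ρ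
  refine memLp_top_of_bound hc.aestronglyMeasurable (D / ρ) (Eventually.of_forall fun x => ?_)
  have : 0 ≤ min (Metric.infDist x E) D := le_min Metric.infDist_nonneg hD
  rw [Complex.norm_real, distFun, Real.norm_of_nonneg (div_nonneg this hρ.le)]
  gcongr
  exact min_le_right _ _

/-- Bounded commutators with the distance function to `E` give off-diagonal decay. -/
theorem pow_mul_norm_block_le {E F : Set X} (hE : MeasurableSet E) (hF : MeasurableSet F)
    {D ρ : ℝ} (hD : 0 ≤ D) (hρ : 0 < ρ) (hEne : E.Nonempty)
    (hEF : ∀ x ∈ F, ∀ y ∈ E, D ≤ dist x y) {T : Lp ℂ 2 μ →L[ℂ] Lp ℂ 2 μ} {N : ℕ} {q b : ℝ}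
    (hT : CommBound (mulOp μ (memLp_distFun E hD hρ)) N T q b) :
    (D / ρ) ^ N * ‖cutoff μ hE * T * cutoff μ hF‖ ≤ q * b ^ N := by
  set e := mulOp μ (memLp_distFun (μ := μ) E hD hρ) with he
  have h1 : cutoff μ hE * e = 0 := by
    rw [← (commute_mulOp_cutoff _ hE).eq, ← zero_smul ℂ (cutoff μ hE)]
    refine mulOp_mul_cutoff_eq _ hE 0 fun x hx => ?_
    rw [distFun, Metric.infDist_zero_of_mem hx, min_eq_left hD, zero_div, Complex.ofReal_zero]
  have h2 : e * cutoff μ hF = ((D / ρ : ℝ) : ℂ) • cutoff μ hF := by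
    refine mulOp_mul_cutoff_eq _ hF _ fun x hx => ?_
    rw [distFun, min_eq_right ((Metric.le_infDist hEne).mpr fun {y} hy => hEF x hx y hy)]
  have h3 := comm_pow_block_eq h1 h2 T N
  have h4 : ‖cutoff μ hE * (comm e ^ N) T * cutoff μ hF‖ ≤ q * b ^ N := by
    refine (norm_mul_le _ _).trans ((mul_le_of_le_one_right (norm_nonneg _)
      (norm_cutoff_le hF)).trans ?_)
    refine (norm_mul_le _ _).trans ((mul_le_of_le_one_left (norm_nonneg _)
      (norm_cutoff_le hE)).trans (hT N le_rfl))
  rw [h3, norm_smul, norm_pow, norm_neg, Complex.norm_real,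
    Real.norm_of_nonneg (div_nonneg hD hρ.le)] at h4
  exact h4

end OffDiagonal

/-- Boundedness and decay of integer order `N ≥ M` combine to decay of order `M`. -/
theorem le_mul_one_add_rpow_neg {x y Q b M : ℝ} {N : ℕ} (hx : 0 ≤ x) (hy : y ≤ Q) (hQ : 0 < Q)
    (hb : 1 ≤ b) (hM : 0 < M) (hMN : M ≤ N) (h : x ^ N * y ≤ Q * b ^ N) :
    y ≤ Q * b ^ N * 2 ^ M * (1 + x) ^ (-M) := by
  have hbN : 1 ≤ b ^ N := one_le_pow₀ hb
  rw [Real.rpow_neg (by positivity), ← div_eq_mul_inv, le_div_iff₀ (by positivity)]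
  rcases le_total x 1 with h1 | h1
  · have h2 : (1 + x) ^ M ≤ 2 ^ M := Real.rpow_le_rpow (by positivity) (by linarith) hM.le
    calc y * (1 + x) ^ M ≤ Q * (1 + x) ^ M := by gcongr
      _ ≤ (Q * b ^ N) * 2 ^ M := by
        gcongr
        exact le_mul_of_one_le_right hQ.le hbN
  · rcases le_total y 0 with hy0 | hy0
    · refine (mul_nonpos_of_nonpos_of_nonneg hy0 (by positivity)).trans (by positivity)
    have h2 : (1 + x) ^ M ≤ 2 ^ M * x ^ N := by
      calc (1 + x) ^ M ≤ (2 * x) ^ M := Real.rpow_le_rpow (by positivity) (by linarith) hM.le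
        _ = 2 ^ M * x ^ M := Real.mul_rpow (by norm_num) hx
        _ ≤ 2 ^ M * x ^ (N : ℝ) := by gcongr
        _ = _ := by rw [Real.rpow_natCast]
    calc y * (1 + x) ^ M ≤ y * (2 ^ M * x ^ N) := by gcongr
      _ = 2 ^ M * (x ^ N * y) := by ring
      _ ≤ 2 ^ M * (Q * b ^ N) := by gcongr
      _ = _ := by ring

end OffDiag

theorem proposition2p6
    (m n A CDG cDG : ℝ) (hm : 2 ≤ m) (hn : 0 < n) (hA : 0 < A) (hCDG : 0 < CDG) (hcDG : 0 < cDG)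
    (φ : ℝ → ℂ) (hφ : ContDiff ℝ (⊤ : ℕ∞) φ) (hφsupp : tsupport φ ⊆ Set.Icc (1 / 4) 4)
    (M : ℝ) (hM : 0 < M) (K : ℕ) (hK : 1 ≤ K) :
    ∃ C : ℝ, 0 < C ∧
      ∀ (X : Type*) [MetricSpace X] [MeasurableSpace X] [BorelSpace X] (μ : Measure X)
        (L : OffDiag.NonnegSelfAdjoint (Lp ℂ 2 μ)),
        OffDiag.HomogeneousType μ A n →
        OffDiag.DaviesGaffney L m CDG cDG →
        ∀ (s t : ℝ) (k : ℕ), 0 < s → 0 < t → 1 ≤ k →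
        ∀ (c : ℝ), 1 / 4 ≤ c →
        ∀ (x₁ x₂ : X) (r : ℝ), c * ((2 : ℝ) ^ ((m - 1) * k / m) * t ^ (1 / m)) ≤ r →
        ∀ f : Lp ℂ 2 μ,
          ‖OffDiag.ballCutoff μ x₁ r (((1 - L.heat s) ^ K * L.schrodinger t *
              L.funcCalc (fun l => φ ((2 : ℝ) ^ (-(k : ℝ)) * (t * l))))
                (OffDiag.ballCutoff μ x₂ r f))‖ ≤
            C * (1 + OffDiag.setDist (Metric.ball x₁ r) (Metric.ball x₂ r) /
              ((2 : ℝ) ^ ((m - 1) * k / m) * t ^ (1 / m))) ^ (-M) *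
              ‖OffDiag.ballCutoff μ x₂ r f‖ := by
  open OffDiag in
  obtain ⟨N, hN⟩ := exists_nat_ge M
  have hm1 : 0 < m - 1 := by linarith
  have hp : 1 ≤ m / (m - 1) := by rw [le_div_iff₀ hm1]; linarith
  obtain ⟨Q₀, -, h₀⟩ := exists_commBound_of_offDiagonal hn hA hCDG hcDG hp N
  obtain ⟨Q, b, hQ, hb, h₁⟩ := exists_commBound_localized hφ hφsupp K N Q₀
  refine ⟨Q * b ^ N * 2 ^ M, by positivity, ?_⟩
  intro X _ _ _ μ L hμ hDG s t k hs ht hk c hc x₁ x₂ r hr f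
  set W : ℝ := (2 : ℝ) ^ ((m - 1) * k / m) * t ^ (1 / m) with hW
  have hW0 : 0 < W := by positivity
  have hr0 : 0 < r := lt_of_lt_of_le (mul_pos (by linarith) hW0) hr
  set D := setDist (Metric.ball x₁ r) (Metric.ball x₂ r) with hD
  have hDbdd : ∀ d ∈ Set.image2 dist (Metric.ball x₁ r) (Metric.ball x₂ r), 0 ≤ d := by
    rintro _ ⟨x, _, y, _, rfl⟩
    exact dist_nonneg
  have hD0 : 0 ≤ D := Real.sInf_nonneg hDbdd
  have hDle : ∀ x ∈ Metric.ball x₂ r, ∀ y ∈ Metric.ball x₁ r, D ≤ dist x y := fun x hx y hy => by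
    rw [dist_comm]
    exact csInf_le ⟨0, hDbdd⟩ (Set.mem_image2_of_mem hy hx)
  rcases subsingleton_or_nontrivial (Lp ℂ 2 μ) with hsub | hnt
  · rw [Subsingleton.elim (OffDiag.ballCutoff μ x₁ r _) 0, norm_zero]
    positivity
  -- The spectral scale: `φ` localizes `L` to `1 / τ`, where `e^{itL}` propagates over distances
  -- of order `2 ^ k τ^{1/m} = W`.
  set τ : ℝ := (2 : ℝ) ^ (-(k : ℝ)) * t with hτ
  have hτ0 : 0 < τ := by positivity
  set ρ : ℝ := τ ^ (1 / m) with hρ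
  have hρ0 : 0 < ρ := by positivity
  have hR : t / τ = ((2 ^ k : ℕ) : ℝ) := by
    rw [hτ, Real.rpow_neg (by norm_num), Real.rpow_natCast]
    push_cast
    field_simp
  have hWρ : W = ((2 ^ k : ℕ) : ℝ) * ρ := by
    rw [hW, hρ, hτ, Real.mul_rpow (by positivity) ht.le, ← Real.rpow_mul (by norm_num), ← mul_assoc]
    congr 1
    push_cast
    rw [← Real.rpow_natCast, ← Real.rpow_add (by norm_num)]
    congr 1
    field_simp
    ring
  set T := (1 - L.heat s) ^ K * L.schrodinger t *
    L.funcCalc (fun l => φ ((2 : ℝ) ^ (-(k : ℝ)) * (t * l))) with hT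
  have hTeq : T = (1 - L.heat s) ^ K * L.schrodinger t * L.funcCalc fun l => φ (τ * l) := by
    rw [hT, hτ]; simp only [mul_assoc]
  have hheat := h₀ X μ hμ (L.heat τ) ρ hρ0 (hDG τ hτ0) (distFun (Metric.ball x₁ r) D ρ)
    (memLp_distFun _ hD0 hρ0) (abs_distFun_sub_le _ D hρ0)
  have hTb := h₁ (Lp ℂ 2 μ) L τ hτ0 _ hheat s t (2 ^ k) hs Nat.one_le_two_pow hR
  rw [← hTeq] at hTb
  have hdecay : (D / ρ) ^ N * ‖ballCutoff μ x₁ r * T * ballCutoff μ x₂ r‖ ≤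
      Q * (((2 ^ k : ℕ) : ℝ) * b) ^ N :=
    pow_mul_norm_block_le _ _ hD0 hρ0 (Metric.nonempty_ball.mpr hr0) hDle hTb
  have hbound : ‖ballCutoff μ x₁ r * T * ballCutoff μ x₂ r‖ ≤ Q := by
    refine (norm_mul_le _ _).trans ((mul_le_of_le_one_right (norm_nonneg _)
      (norm_cutoff_le _)).trans ?_)
    exact (norm_mul_le _ _).trans ((mul_le_of_le_one_left (norm_nonneg _)
      (norm_cutoff_le _)).trans hTb.norm_le)
  have hRpos : (0 : ℝ) < ((2 ^ k : ℕ) : ℝ) := by positivity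
  have hdecay' : (D / W) ^ N * ‖ballCutoff μ x₁ r * T * ballCutoff μ x₂ r‖ ≤ Q * b ^ N := by
    have e1 : D / ρ = ((2 ^ k : ℕ) : ℝ) * (D / W) := by rw [hWρ]; field_simp
    rw [e1, mul_pow, mul_pow] at hdecay
    refine le_of_mul_le_mul_left ?_ (pow_pos hRpos N)
    calc _ = (((2 ^ k : ℕ) : ℝ)) ^ N * (D / W) ^ N *
          ‖ballCutoff μ x₁ r * T * ballCutoff μ x₂ r‖ := by ring
      _ ≤ _ := hdecay
      _ = _ := by ring
  have hfinal := le_mul_one_add_rpow_neg (div_nonneg hD0 hW0.le) hbound hQ hb hM hN hdecay'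
  have hPf : ballCutoff μ x₁ r (T (ballCutoff μ x₂ r f)) =
      (ballCutoff μ x₁ r * T * ballCutoff μ x₂ r) (ballCutoff μ x₂ r f) := by
    have hidem : ballCutoff μ x₂ r (ballCutoff μ x₂ r f) = ballCutoff μ x₂ r f :=
      DFunLike.congr_fun (cutoff_mul_self Metric.isOpen_ball.measurableSet) f
    change _ = ballCutoff μ x₁ r (T (ballCutoff μ x₂ r (ballCutoff μ x₂ r f)))
    rw [hidem]
  rw [hPf]
  exact ContinuousLinearMap.le_of_opNorm_le _ hfinal _
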